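/- Let $G$ be a locally compact, second countable (Hausdorff) topological group with a left Haar measure $\mu$, and let $A$ be a Polish $G$-module, i.e. a Polish Abelian topological group with a jointly continuous action of $G$ by automorphisms. For $n\ge 1$ let $\mathcal{C}(G^n,A)^G$ be the group of Haar-a.e. equivalence classes of measurable functions $\sigma:G^n\to A$ that are fixed by the diagonal action $(g\cdot\sigma)(g_1,\dots,g_n)=g\cdot\sigma(g^{-1}g_1,\dots,g^{-1}g_n)$ for every $g \in G$, and let \[d\sigma(g_1,\dots,g_{n+1})=\sum_{i=1}^{n+1}(-1)^{n+1-i}\sigma(g_1,\dots,\widehat{g_i},\dots,g_{n+1}).\] For $p\ge 0$ let $\mathrm{H}^p_{\mathrm m}(G,A)$ be the cohomology at $\mathcal{C}(G^{p+1},A)^G$ of the complex $0\to\mathcal{C}(G,A)^G\xrightarrow{d}\mathcal{C}(G^2,A)^G\xrightarrow{d}\mathcal{C}(G^3,A)^G\xrightarrow{d}\cdots$. A function $\gamma:G^{n}\to A$ is of \emph{type I} if every point has a neighbourhood on which $\gamma$ takes only finitely many values, and there is an open set of full $\mu^{n}$-measure on which $\gamma$ is locally constant. A function is \emph{almost type-I}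 if it is a limit of a sequence of type-I functions, uniformly on compact sets; it is \emph{regular} at a point $x_0$ if the type-I functions in such a sequence can be chosen so that each of them is constant on some neighbourhood of $x_0$. Theorem. For every $p\ge 0$, every class in $\mathrm{H}^p_{\mathrm m}(G,A)$ is represented by a Borel measurable function $f:G^{p+1}\to A$ such that: 1. $f$ is $G$-equivariant, $f(gg_1,\dots,gg_{p+1})=g\cdot f(g_1,\dots,g_{p+1})$, and satisfies $df=0$, both at every point; 2. $f$ is almost type-I and regular at the identity $(e,\dots,e)$ of $G^{p+1}$; 3. there is a dense $G_\delta$ set $S\subseteq G^{p+1}$ whose complement is $\mu^{p+1}$-null, with $(e,\dots,e)\in S$, such that $f$ is continuous at every point of $S$. -/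

import Mathlib

open MeasureTheory Filter Topology

namespace MooreCohomology

theorem quasiMeasurePreserving_removeNth {G : Type*} [MeasurableSpace G] (μ : Measure G)
    [SigmaFinite μ] {n : ℕ} (i : Fin (n + 1)) :
    Measure.QuasiMeasurePreserving (fun x : Fin (n + 1) → G => i.removeNth x)
      (Measure.pi fun _ => μ) (Measure.pi fun _ => μ) :=
  Measure.quasiMeasurePreserving_snd.comp
    (measurePreserving_piFinSuccAbove (fun _ => μ) i).quasiMeasurePreserving

set_option linter.unusedSectionVars false

/-- The alternating-sum differential on actual functions. -/
def dFun {G A : Type*} [AddCommGroup A] {n : ℕ} (f : (Fin n → G) → A) :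
    (Fin (n + 1) → G) → A :=
  fun x => ∑ i : Fin (n + 1), (-1 : ℤ) ^ (n - (i : ℕ)) • f (i.removeNth x)

theorem dFun_dFun {G A : Type*} [AddCommGroup A] {n : ℕ} (f : (Fin n → G) → A)
    (x : Fin (n + 2) → G) : dFun (dFun f) x = 0 := by
  have key : ∀ (i : Fin (n + 2)) (j : Fin (n + 1)),
      (-1 : ℤ) ^ (n + 1 - (i : ℕ)) * (-1) ^ (n - (j : ℕ)) +
        (-1) ^ (n + 1 - (i.succAbove j : ℕ)) * (-1) ^ (n - (j.predAbove i : ℕ)) = 0 := by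
    intro i j
    have hi := i.2
    have hj := j.2
    rcases lt_or_ge j.castSucc i with h | h
    · have h' : (j : ℕ) < i := h
      rw [Fin.succAbove_of_castSucc_lt _ _ h, Fin.predAbove_of_castSucc_lt _ _ h]
      simp only [Fin.val_castSucc, Fin.val_pred]
      rw [show n + 1 - (j : ℕ) = (n - j) + 1 by omega,
        show n - ((i : ℕ) - 1) = n + 1 - i by omega]
      ring
    · have h' : (i : ℕ) ≤ j := h
      rw [Fin.succAbove_of_le_castSucc _ _ h, Fin.predAbove_of_le_castSucc _ _ h]
      simp only [Fin.val_succ, Fin.coe_castPred]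
      rw [show n + 1 - ((j : ℕ) + 1) = n - j by omega,
        show n + 1 - (i : ℕ) = (n - i) + 1 by omega]
      ring
  simp only [dFun, Finset.smul_sum, smul_smul]
  rw [← Finset.sum_product']
  refine Finset.sum_involution (fun q _ => (q.1.succAbove q.2, q.2.predAbove q.1)) ?_ ?_ ?_ ?_
  · rintro ⟨i, j⟩ -
    rw [Fin.removeNth_removeNth_eq_swap x j i, ← add_smul, key i j, zero_smul]
  · rintro ⟨i, j⟩ - - h
    exact Fin.succAbove_ne i j (congrArg Prod.fst h)|>.elim
  · simp
  · rintro ⟨i, j⟩ -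
    ext1
    · exact Fin.succAbove_succAbove_predAbove i j
    · exact Fin.predAbove_predAbove_succAbove i j

section Cohomology

variable {G : Type*} [Group G] [TopologicalSpace G] [IsTopologicalGroup G]
  [LocallyCompactSpace G] [SecondCountableTopology G] [MeasurableSpace G] [BorelSpace G]
variable (μ : Measure G) [μ.IsHaarMeasure]
variable (A : Type*) [AddCommGroup A] [TopologicalSpace A] [IsTopologicalAddGroup A]

/-- The product measure `μ^n` on `G^n`; if `μ` is a left Haar measure on `G` then this is a left
Haar measure on `G^n`. -/
noncomputable abbrev powMeasure {G : Type*} [MeasurableSpace G] (μ : Measure G) (n : ℕ) :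
    Measure (Fin n → G) :=
  Measure.pi fun _ => μ

/-- The group `C(G^n, A)` of Haar-a.e. equivalence classes of measurable functions `G^n → A`. -/
abbrev Cochain {G : Type*} [MeasurableSpace G] (μ : Measure G) (A : Type*) [TopologicalSpace A]
    (n : ℕ) : Type _ :=
  (Fin n → G) →ₘ[powMeasure μ n] A

theorem measurePreserving_translate (n : ℕ) (g : G) :
    MeasurePreserving (fun (x : Fin n → G) i => g * x i) (powMeasure μ n) (powMeasure μ n) :=
  measurePreserving_pi _ _ fun _ => measurePreserving_mul_left μ g

variable {A} in
/-- The diagonal action of `g` on `C(G^n, A)`: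
`(g • φ)(x₁, …, xₙ) = g • φ(g⁻¹ x₁, …, g⁻¹ xₙ)`. -/
noncomputable def diagAct [DistribMulAction G A] [ContinuousSMul G A] {n : ℕ} (g : G) :
    Cochain μ A n →+ Cochain μ A n :=
  AddMonoidHom.mk'
    (fun φ => AEEqFun.comp (fun a : A => g • a) (continuous_const_smul g)
      (φ.compMeasurePreserving (fun x i => g⁻¹ * x i) (measurePreserving_translate μ n g⁻¹)))
    (by
      rintro ⟨φ, hφ⟩ ⟨ψ, hψ⟩
      exact AEEqFun.mk_eq_mk.2 (Eventually.of_forall fun x => smul_add g _ _))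

/-- The alternating-sum differential `C(G^n, A) → C(G^(n+1), A)`. The face that omits the last
variable has coefficient `+1`. -/
noncomputable def d (n : ℕ) : Cochain μ A n →+ Cochain μ A (n + 1) :=
  ∑ i : Fin (n + 1), (-1 : ℤ) ^ (n - (i : ℕ)) •
    AddMonoidHom.mk' (fun σ : Cochain μ A n =>
      σ.compQuasiMeasurePreserving (fun x => i.removeNth x) (quasiMeasurePreserving_removeNth μ i))
      (by rintro ⟨φ, hφ⟩ ⟨ψ, hψ⟩; rfl)

/-- The differential of a class is the class of the differential. -/
theorem coeFn_d {n : ℕ} (σ : Cochain μ A n) : d μ A n σ =ᵐ[powMeasure μ (n + 1)] dFun σ := by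
  unfold d dFun
  simp only [AddMonoidHom.finsetSum_apply]
  induction (Finset.univ : Finset (Fin (n + 1))) using Finset.induction_on with
  | empty => exact AEEqFun.coeFn_zero
  | insert a s ha ih =>
    simp only [Finset.sum_insert ha]
    refine (AEEqFun.coeFn_add _ _).trans (EventuallyEq.add ?_ ih)
    refine (AEEqFun.coeFn_smul _ _).trans ?_
    filter_upwards [AEEqFun.coeFn_compQuasiMeasurePreserving σ
      (quasiMeasurePreserving_removeNth μ a)] with x hx
    exact congrArg _ hx

theorem dFun_congr {n : ℕ} {f g : (Fin n → G) → A} (h : f =ᵐ[powMeasure μ n] g) :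
    dFun f =ᵐ[powMeasure μ (n + 1)] dFun g := by
  have : ∀ᵐ x ∂powMeasure μ (n + 1), ∀ i : Fin (n + 1), f (i.removeNth x) = g (i.removeNth x) :=
    ae_all_iff.2 fun i => (quasiMeasurePreserving_removeNth μ i).ae h
  filter_upwards [this] with x hx
  simp only [dFun, hx]

theorem d_d {n : ℕ} (σ : Cochain μ A n) : d μ A (n + 1) (d μ A n σ) = 0 := by
  refine AEEqFun.ext ((coeFn_d μ A _).trans (((dFun_congr μ A (coeFn_d μ A σ)).trans ?_).trans
    AEEqFun.coeFn_zero.symm))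
  exact Eventually.of_forall (dFun_dFun _)

variable [DistribMulAction G A] [ContinuousSMul G A]

theorem coeFn_diagAct {n : ℕ} (g : G) (φ : Cochain μ A n) :
    diagAct μ g φ =ᵐ[powMeasure μ n] fun x => g • φ (fun i => g⁻¹ * x i) := by
  refine (AEEqFun.coeFn_comp _ (continuous_const_smul g) _).trans ?_
  filter_upwards [AEEqFun.coeFn_compMeasurePreserving φ (measurePreserving_translate μ n g⁻¹)]
    with x hx
  exact congrArg (fun a => g • a) hx

theorem diagAct_d {n : ℕ} (g : G) (φ : Cochain μ A n) :
    diagAct μ g (d μ A n φ) = d μ A n (diagAct μ g φ) := by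
  refine AEEqFun.ext ((coeFn_diagAct μ A g _).trans (EventuallyEq.trans ?_
    ((coeFn_d μ A _).trans (dFun_congr μ A (coeFn_diagAct μ A g φ))).symm))
  filter_upwards [(measurePreserving_translate μ (n + 1) g⁻¹).quasiMeasurePreserving.ae
    (coeFn_d μ A φ)] with x hx
  rw [hx]
  simp only [dFun, Finset.smul_sum]
  exact Finset.sum_congr rfl fun i _ => smul_comm _ _ _

/-- The subgroup `C(G^n, A)^G` of classes that are fixed by the diagonal action. -/
noncomputable def invariants (n : ℕ) : AddSubgroup (Cochain μ A n) :=
  ⨅ g : G, (diagAct μ g).eqLocus (AddMonoidHom.id (Cochain μ A n))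

/-- `Z^p(G, A)`, the kernel of the differential on `C(G^(p+1), A)^G`. -/
noncomputable def cocycles (p : ℕ) : AddSubgroup (Cochain μ A (p + 1)) :=
  invariants μ A (p + 1) ⊓ (d μ A (p + 1)).ker

/-- `B^p(G, A)`, the image of the preceding term in the complex
`0 → C(G, A)^G → C(G², A)^G → C(G³, A)^G → ⋯`. -/
noncomputable def coboundaries : (p : ℕ) → AddSubgroup (Cochain μ A (p + 1))
  | 0 => ⊥
  | p + 1 => (invariants μ A (p + 1)).map (d μ A (p + 1))

/-- Coboundaries are cocycles. -/
theorem coboundaries_le_cocycles (p : ℕ) : coboundaries μ A p ≤ cocycles μ A p := by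
  cases p with
  | zero => exact bot_le
  | succ p =>
    rintro _ ⟨φ, hφ, rfl⟩
    refine ⟨AddSubgroup.mem_iInf.2 fun g => ?_, d_d μ A φ⟩
    exact (diagAct_d μ A g φ).trans (congrArg _ (AddSubgroup.mem_iInf.1 hφ g))

/-- Moore's measurable cohomology group `H^p_m(G, A) = Z^p(G, A) / B^p(G, A)`. -/
abbrev Hm (p : ℕ) : Type _ :=
  cocycles μ A p ⧸ (coboundaries μ A p).addSubgroupOf (cocycles μ A p)

end Cohomology

section TypeI

variable {X : Type*} [TopologicalSpace X] {A : Type*}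

/-- `f` is locally constant around `x`: it is constant on a neighbourhood of `x`. -/
def LocallyConstantAround (f : X → A) (x : X) : Prop :=
  ∀ᶠ y in 𝓝 x, f y = f x

/-- Type-I functions: locally finite-valued, and locally constant on an open set of full
measure. -/
def IsTypeI [MeasurableSpace X] (ν : Measure X) (f : X → A) : Prop :=
  (∀ x, ∃ V ∈ 𝓝 x, (f '' V).Finite) ∧
    ∃ U : Set X, IsOpen U ∧ ν Uᶜ = 0 ∧ ∀ x ∈ U, LocallyConstantAround f x

variable [AddCommGroup A] [TopologicalSpace A]

/-- Locally uniform convergence of a sequence of functions from a locally compact space to a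
topological group, that is, uniform convergence on compact sets. -/
def TendstoCompactly (γ : ℕ → X → A) (f : X → A) : Prop :=
  ∀ K : Set X, IsCompact K → ∀ V ∈ 𝓝 (0 : A), ∀ᶠ n in atTop, ∀ x ∈ K, γ n x - f x ∈ V

/-- Almost type-I functions: locally uniform limits of type-I functions. -/
def IsAlmostTypeI [MeasurableSpace X] (ν : Measure X) (f : X → A) : Prop :=
  ∃ γ : ℕ → X → A, (∀ n, IsTypeI ν (γ n)) ∧ TendstoCompactly γ f

/-- Regularity of an almost type-I function `f` at `x₀`: `f` is a locally uniform limit of type-I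
functions each of which is locally constant around `x₀`. -/
def IsRegularAt [MeasurableSpace X] (ν : Measure X) (f : X → A) (x₀ : X) : Prop :=
  ∃ γ : ℕ → X → A,
    (∀ n, IsTypeI ν (γ n) ∧ LocallyConstantAround (γ n) x₀) ∧ TendstoCompactly γ f

end TypeI

end MooreCohomology

/-! The proof is a dimension shift that trades variables in which cochains are only measurable
classes for variables in which they are controlled at every point. For each `m`, the group `C(G^m,
A)` carries convergence in measure on compact sets, encoded by the chain `smallSet`. Without
invariance, the complex of these groups is exact: freezing the last variable of a cocycle at a
generic `t` gives a primitive. By Fubini and Markov, `t` can be chosen so that small cocycles get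
small primitives, so `d` is open onto the next kernel (`exists_d_eq`).

Start from a cocycle `σ` on `G^(p+1)` and a primitive of `±σ` in `C(G^p, A)`, extended equivariantly
to a map from `G` to `C(G^p, A)`. Its differential in the outer variable takes values in the kernel
of the inner `d`. Lifting it through that `d` and extending equivariantly gives a map from `G²` to
`C(G^(p-1), A)`, and so on. After `p` steps the values lie in `C(G^0, A)`, which is `A` itself.
There the inner `d` is injective and the only null set is empty, so the cocycle identity and
equivariance hold at every point.

Regularity survives each step. A locally uniform limit of type-I functions lifts to another through
an open homomorphism with complete source, by lifting successive differences of the approximants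
(`NiceAt.exists_lift`). The continuous action preserves such limits as well (`NiceAt.twist`). All
approximants are locally constant on a common `G_δ` set of full measure containing the identity, and
the limit is continuous there.

That the class does not change is checked in the double complex of equivariant functions on `G^k ×
G^m`. Jointly measurable representatives of the shifted cochains are compared with `σ` on
concatenated tuples, and exactness of the rows, with an equivariant primitive, carries the
difference from one stage to the next (`exists_shifted_cochain`). -/

namespace MooreCohomology

/-! ### Completeness of Polish Abelian groups -/

section PolishComplete

/-- The complete metric is kept as a bare function, so that it puts no uniform structure on `X`: the
group uniformity used below may be a different one. -/
theorem exists_dist_of_isCompletelyMetrizableSpace (X : Type*) [TopologicalSpace X]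
    [TopologicalSpace.IsCompletelyMetrizableSpace X] :
    ∃ D : X → X → ℝ, (∀ x, ∀ ε > 0, ∃ s ∈ 𝓝 x, ∀ a ∈ s, ∀ b ∈ s, D a b < ε) ∧
      ∀ F : Filter X, F.NeBot → (∀ ε > 0, ∃ s ∈ F, ∀ a ∈ s, ∀ b ∈ s, D a b < ε) →
        ∃ x, F ≤ 𝓝 x := by
  let := TopologicalSpace.upgradeIsCompletelyMetrizable X
  refine ⟨dist, fun x ε hε => ⟨Metric.ball x (ε / 2), Metric.ball_mem_nhds x (half_pos hε), ?_⟩, ?_⟩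
  · intro a ha b hb
    calc dist a b ≤ dist a x + dist b x := dist_triangle_right a b x
      _ < ε / 2 + ε / 2 := add_lt_add ha hb
      _ = ε := add_halves ε
  · intro F hF h
    exact CompleteSpace.complete (Metric.cauchy_iff.2 ⟨hF, h⟩)

/-- A completely metrizable dense subspace of a Hausdorff space is a `G_δ`. -/
theorem _root_.IsDenseInducing.isGδ_range {X Y : Type*} [TopologicalSpace X]
    [TopologicalSpace Y] [TopologicalSpace.IsCompletelyMetrizableSpace X] [T2Space Y] {i : X → Y}
    (hi : IsDenseInducing i) : IsGδ (Set.range i) := by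
  obtain ⟨D, hD, hcomp⟩ := exists_dist_of_isCompletelyMetrizableSpace X
  -- A point of every `O n` has a trace filter on `X` that is Cauchy for `D`. The filter converges
  -- in `X`, and the Hausdorff property identifies the point with the image of the limit.
  let O : ℕ → Set Y := fun n =>
    ⋃₀ {U | IsOpen U ∧ ∀ a b, i a ∈ U → i b ∈ U → D a b < 1 / ((n : ℝ) + 1)}
  have hO : ∀ n, IsOpen (O n) := fun n => isOpen_sUnion fun U hU => hU.1
  have : Set.range i = ⋂ n, O n := by
    apply Set.Subset.antisymm
    · rintro _ ⟨x, rfl⟩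
      refine Set.mem_iInter.2 fun n => ?_
      obtain ⟨s, hs, hsD⟩ := hD x (1 / ((n : ℝ) + 1)) Nat.one_div_pos_of_nat
      rw [hi.nhds_eq_comap, mem_comap] at hs
      obtain ⟨t, ht, hts⟩ := hs
      obtain ⟨U, hUt, hU, hxU⟩ := mem_nhds_iff.1 ht
      exact ⟨U, ⟨hU, fun a b ha hb => hsD a (hts (hUt ha)) b (hts (hUt hb))⟩, hxU⟩
    · intro y hy
      have hne := hi.comap_nhds_neBot y
      obtain ⟨x, hx⟩ := hcomp (comap i (𝓝 y)) hne (by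
        intro ε hε
        obtain ⟨n, hn⟩ := exists_nat_one_div_lt hε
        obtain ⟨U, ⟨hU, hUD⟩, hyU⟩ := Set.mem_iInter.1 hy n
        exact ⟨i ⁻¹' U, preimage_mem_comap (hU.mem_nhds hyU),
          fun a ha b hb => (hUD a b ha hb).trans hn⟩)
      refine ⟨x, tendsto_nhds_unique (f := i) (l := comap i (𝓝 y)) ?_ tendsto_comap⟩
      exact (hi.continuous.tendsto x).mono_left hx
  rw [this]
  exact .iInter_of_isOpen hO

/-- A Polish Abelian group is complete. -/
theorem completeSpace_of_isCompletelyMetrizableSpace (A : Type*) [AddCommGroup A] [UniformSpace A]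
    [IsUniformAddGroup A] [TopologicalSpace.IsCompletelyMetrizableSpace A] : CompleteSpace A := by
  have := IsUniformAddGroup.uniformity_countably_generated (α := A)
  let := UniformSpace.pseudoMetricSpace A
  let i : A → UniformSpace.Completion A := (↑)
  have hi : IsDenseInducing i := UniformSpace.Completion.isDenseInducing_coe
  have hsurj : Function.Surjective i := by
    intro x
    -- By Baire, the dense `G_δ` image of `A` meets its translate by `-x`. At a common point `y = a`
    -- and `y + x = b`, whence `x = b - a`.
    let h : UniformSpace.Completion A ≃ₜ UniformSpace.Completion A := Homeomorph.addRight x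
    have hd : Dense (Set.range i ∩ h ⁻¹' Set.range i) :=
      Dense.inter_of_Gδ hi.isGδ_range (hi.isGδ_range.preimage h.continuous)
        hi.dense (hi.dense.preimage h.isOpenMap)
    obtain ⟨y, ⟨a, ha⟩, b, hb⟩ := hd.nonempty
    refine ⟨b - a, ?_⟩
    change ((b - a : A) : UniformSpace.Completion A) = x
    have hb' : (b : UniformSpace.Completion A) = y + x := hb
    have ha' : (a : UniformSpace.Completion A) = y := ha
    rw [UniformSpace.Completion.coe_sub, hb', ha', add_sub_cancel_left]
  exact ((UniformSpace.Completion.isUniformInducing_coe A).completeSpace_congr hsurj).2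
    inferInstance

end PolishComplete

/-! ### Additive chains and neighbourhoods of zero -/

section Chain

/-- A decreasing sequence of symmetric subsets of an Abelian group containing zero, each of which
contains the sum of two copies of the next one. -/
structure IsAddChain {E : Type*} [AddCommGroup E] (W : ℕ → Set E) : Prop where
  zero_mem : ∀ n, 0 ∈ W n
  neg_mem : ∀ n, ∀ a ∈ W n, -a ∈ W n
  add_mem : ∀ n, ∀ a ∈ W (n + 1), ∀ b ∈ W (n + 1), a + b ∈ W n

variable {E : Type*} [AddCommGroup E] {W : ℕ → Set E} (hW : IsAddChain W)
include hW

theorem IsAddChain.antitone : Antitone W :=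
  antitone_nat_of_succ_le fun n a ha => by
    simpa using hW.add_mem n a ha 0 (hW.zero_mem _)

theorem IsAddChain.sub_mem {n : ℕ} {a b : E} (ha : a ∈ W (n + 1)) (hb : b ∈ W (n + 1)) :
    a - b ∈ W n := by
  rw [sub_eq_add_neg]
  exact hW.add_mem n _ ha _ (hW.neg_mem _ _ hb)

/-- The analogue of `2^-(N+1) + 2^-(N+2) + ⋯ ≤ 2^-N`: after the first term is split off, the tail
lies in `W (N + 1)` by induction. -/
theorem IsAddChain.sum_mem {a : ℕ → E} (N M : ℕ) (ha : ∀ n, N + 1 ≤ n → n < M → a n ∈ W n) :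
    ∑ i ∈ Finset.Ico (N + 1) M, a i ∈ W N := by
  rcases le_or_gt M (N + 1) with h | h
  · rw [Finset.Ico_eq_empty_of_le h]
    exact hW.zero_mem _
  · obtain ⟨k, rfl⟩ := Nat.exists_eq_add_of_lt h
    induction k generalizing N with
    | zero => simpa using hW.antitone (Nat.le_succ N) (ha (N + 1) le_rfl (by omega))
    | succ k ih =>
      rw [Finset.sum_eq_sum_Ico_succ_bot (by omega)]
      refine hW.add_mem N _ (ha _ le_rfl (by omega)) _ ?_
      have := ih (N + 1) (fun n h1 h2 => ha n (by omega) (by omega)) (by omega)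
      rwa [show N + 1 + 1 + k + 1 = N + 1 + (k + 1) + 1 by omega] at this

end Chain

section NhdsChain

/-- An additive chain of open sets that form a neighbourhood basis of zero. -/
structure IsNhdsChain {A : Type*} [AddCommGroup A] [TopologicalSpace A] (V : ℕ → Set A) : Prop
    extends IsAddChain V where
  isOpen : ∀ n, IsOpen (V n)
  exists_subset : ∀ U ∈ 𝓝 (0 : A), ∃ n, V n ⊆ U

variable {A : Type*} [AddCommGroup A] [TopologicalSpace A]

open scoped Pointwise in
theorem exists_isNhdsChain [IsTopologicalAddGroup A] [FirstCountableTopology A] :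
    ∃ V : ℕ → Set A, IsNhdsChain V := by
  obtain ⟨u, hu, hadd⟩ := IsTopologicalAddGroup.exists_antitone_basis_nhds_zero A
  have hmem : ∀ n a, a ∈ interior (u (n + 1)) → ∀ b ∈ interior (u (n + 1)),
      a + b ∈ interior (u n) := by
    intro n a ha b hb
    have h1 : IsOpen (interior (u (n + 1)) + interior (u (n + 1))) := isOpen_interior.add_left
    exact interior_maximal ((Set.add_subset_add interior_subset interior_subset).trans (hadd n)) h1
      (Set.add_mem_add ha hb)
  have h0 : ∀ n, (0 : A) ∈ interior (u n) := fun n => mem_interior_iff_mem_nhds.2 (hu.mem n)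
  refine ⟨fun n => interior (u n) ∩ -interior (u n), ⟨⟨?_, ?_, ?_⟩, ?_, ?_⟩⟩
  · intro n
    exact ⟨h0 n, by simpa using h0 n⟩
  · rintro n a ⟨h1, h2⟩
    exact ⟨h2, by simpa using h1⟩
  · rintro n a ⟨h1, h2⟩ b ⟨h3, h4⟩
    refine ⟨hmem n a h1 b h3, ?_⟩
    rw [Set.mem_neg, neg_add]
    exact hmem n _ h2 _ h4
  · exact fun n => isOpen_interior.inter isOpen_interior.neg
  · intro U hU
    obtain ⟨n, -, hn⟩ := hu.1.mem_iff.1 hU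
    exact ⟨n, Set.inter_subset_left.trans (interior_subset.trans hn)⟩

variable {V : ℕ → Set A} (hV : IsNhdsChain V)
include hV

theorem IsNhdsChain.mem_nhds (n : ℕ) : V n ∈ 𝓝 (0 : A) :=
  (hV.isOpen n).mem_nhds (hV.zero_mem n)

variable [IsTopologicalAddGroup A]

theorem IsNhdsChain.tendsto_iff {ι : Type*} {l : Filter ι} {a : ι → A} {b : A} :
    Tendsto a l (𝓝 b) ↔ ∀ n, ∀ᶠ i in l, a i - b ∈ V n := by
  rw [← tendsto_sub_nhds_zero_iff]
  constructor
  · exact fun h n => h (hV.mem_nhds n)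
  · intro h U hU
    obtain ⟨n, hn⟩ := hV.exists_subset U hU
    exact (h n).mono fun i hi => hn hi

/-- The limit of points of `V (n + 1)` lies in `V n`. -/
theorem IsNhdsChain.mem_of_tendsto {ι : Type*} {l : Filter ι} [l.NeBot] {a : ι → A} {b : A} {n : ℕ}
    (h : Tendsto a l (𝓝 b)) (ha : ∀ᶠ i in l, a i ∈ V (n + 1)) : b ∈ V n := by
  obtain ⟨i, h1, h2⟩ := ((hV.tendsto_iff.1 h (n + 1)).and ha).exists
  simpa using hV.sub_mem h2 h1

theorem IsNhdsChain.exists_tendsto_sum [PolishSpace A] {a : ℕ → A} {N : ℕ}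
    (ha : ∀ n, N ≤ n → a n ∈ V n) :
    ∃ s, Tendsto (fun n => ∑ i ∈ Finset.range n, a i) atTop (𝓝 s) := by
  let : UniformSpace A := IsTopologicalAddGroup.rightUniformSpace A
  have : IsUniformAddGroup A := isUniformAddGroup_of_addCommGroup
  have := completeSpace_of_isCompletelyMetrizableSpace A
  refine cauchySeq_tendsto_of_complete ?_
  rw [cauchySeq_iff]
  intro U hU
  rw [uniformity_eq_comap_nhds_zero A, mem_comap] at hU
  obtain ⟨t, ht, htU⟩ := hU
  obtain ⟨n, hn⟩ := hV.exists_subset t ht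
  -- All partial sums are compared with the one of length `n + N + 2`; the second alternative is the
  -- one shorter sum that the bound on `k` lets in.
  have key : ∀ k, n + N + 1 ≤ k → ∑ i ∈ Finset.range k, a i -
      ∑ i ∈ Finset.range (n + N + 1 + 1), a i ∈ V (n + 1) ∨ k = n + N + 1 := by
    intro k hk
    rcases Nat.eq_or_lt_of_le hk with h | h
    · exact .inr h.symm
    · left
      rw [← Finset.sum_Ico_eq_sub _ (by omega)]
      exact hV.antitone (by omega : n + 1 ≤ n + N + 1)
        (hV.sum_mem (n + N + 1) k fun m h1 h2 => ha m (by omega))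
  refine ⟨n + N + 2, fun k hk l hl => htU (hn ?_)⟩
  have h1 := (key k (by omega)).resolve_right (by omega)
  have h2 := (key l (by omega)).resolve_right (by omega)
  simpa using hV.sub_mem h2 h1

end NhdsChain

end MooreCohomology

namespace MooreCohomology

/-! ### Borel type-I functions -/

section TypeIAt

variable {X Y : Type*} [TopologicalSpace X] [MeasurableSpace X] [TopologicalSpace Y]
  [MeasurableSpace Y] {E F H : Type*}

/-- Borel type-I functions that are locally constant around `x₀`. -/
structure TypeIAt (ν : Measure X) (x₀ : X) (f : X → E) : Prop where
  exists_finite_image : ∀ x, ∃ V ∈ 𝓝 x, (f '' V).Finite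
  exists_isOpen : ∃ U : Set X, IsOpen U ∧ x₀ ∈ U ∧ ν Uᶜ = 0 ∧ ∀ x ∈ U, LocallyConstantAround f x
  measurableSet_preimage : ∀ s : Set E, MeasurableSet (f ⁻¹' s)

variable {ν : Measure X} {x₀ : X} {f : X → E}

theorem TypeIAt.isTypeI (hf : TypeIAt ν x₀ f) : IsTypeI ν f := by
  obtain ⟨U, h1, -, h2, h3⟩ := hf.exists_isOpen
  exact ⟨hf.exists_finite_image, U, h1, h2, h3⟩

theorem TypeIAt.locallyConstantAround (hf : TypeIAt ν x₀ f) : LocallyConstantAround f x₀ := by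
  obtain ⟨U, -, h1, -, h2⟩ := hf.exists_isOpen
  exact h2 _ h1

theorem TypeIAt.finite_image (hf : TypeIAt ν x₀ f) {K : Set X} (hK : IsCompact K) :
    (f '' K).Finite := by
  choose V hV hVf using hf.exists_finite_image
  obtain ⟨t, -, ht⟩ := hK.elim_nhds_subcover V fun x _ => hV x
  refine (t.finite_toSet.biUnion fun x _ => hVf x).subset ?_
  rintro _ ⟨x, hx, rfl⟩
  obtain ⟨y, hy, hxy⟩ := Set.mem_iUnion₂.1 (ht hx)
  exact Set.mem_iUnion₂.2 ⟨y, hy, x, hxy, rfl⟩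

theorem TypeIAt.countable_range [SigmaCompactSpace X] (hf : TypeIAt ν x₀ f) :
    (Set.range f).Countable := by
  rw [← Set.image_univ, ← iUnion_compactCovering, Set.image_iUnion]
  exact Set.countable_iUnion fun n => (hf.finite_image (isCompact_compactCovering X n)).countable

theorem TypeIAt.const (ν : Measure X) (x₀ : X) (a : E) : TypeIAt ν x₀ fun _ => a where
  exists_finite_image x := ⟨Set.univ, univ_mem, (Set.finite_singleton a).subset (by
    rintro _ ⟨y, -, rfl⟩; rfl)⟩
  exists_isOpen := ⟨Set.univ, isOpen_univ, trivial, by simp, fun x _ => Eventually.of_forall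
    fun _ => rfl⟩
  measurableSet_preimage s := measurable_const (MeasurableSpace.measurableSet_top (s := s))

/-- Since `f` has countably many values, preimages are countable unions and nothing is asked of `h`.
The lifts built below can therefore use arbitrary choice functions of the values. -/
theorem TypeIAt.map₂ [SigmaCompactSpace X] {g : X → F} (hf : TypeIAt ν x₀ f) (hg : TypeIAt ν x₀ g)
    (h : E → F → H) : TypeIAt ν x₀ fun x => h (f x) (g x) where
  exists_finite_image x := by
    obtain ⟨V, hV, hVf⟩ := hf.exists_finite_image x
    obtain ⟨V', hV', hVf'⟩ := hg.exists_finite_image x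
    refine ⟨V ∩ V', inter_mem hV hV', (hVf.image2 h hVf').subset ?_⟩
    rintro _ ⟨y, hy, rfl⟩
    exact ⟨f y, ⟨y, hy.1, rfl⟩, g y, ⟨y, hy.2, rfl⟩, rfl⟩
  exists_isOpen := by
    obtain ⟨U, h1, h2, h3, h4⟩ := hf.exists_isOpen
    obtain ⟨U', h1', h2', h3', h4'⟩ := hg.exists_isOpen
    refine ⟨U ∩ U', h1.inter h1', ⟨h2, h2'⟩, ?_, fun x hx => ?_⟩
    · rw [Set.compl_inter]
      exact measure_union_null h3 h3'
    · filter_upwards [h4 x hx.1, h4' x hx.2] with y hy hy'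
      rw [hy, hy']
  measurableSet_preimage s := by
    have : (fun x => h (f x) (g x)) ⁻¹' s =
        ⋃ a ∈ Set.range f, f ⁻¹' {a} ∩ g ⁻¹' {b | h a b ∈ s} := by
      ext x
      simp only [Set.mem_preimage, Set.mem_iUnion, Set.mem_inter_iff, Set.mem_singleton_iff,
        Set.mem_ofPred_eq]
      exact ⟨fun hx => ⟨f x, ⟨x, rfl⟩, rfl, hx⟩, fun ⟨a, _, ha, hx⟩ => ha ▸ hx⟩
    rw [this]
    exact .biUnion hf.countable_range fun a _ =>
      (hf.measurableSet_preimage _).inter (hg.measurableSet_preimage _)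

theorem TypeIAt.map (hf : TypeIAt ν x₀ f) (h : E → F) : TypeIAt ν x₀ fun x => h (f x) where
  exists_finite_image x := by
    obtain ⟨V, hV, hVf⟩ := hf.exists_finite_image x
    refine ⟨V, hV, (hVf.image h).subset ?_⟩
    rintro _ ⟨y, hy, rfl⟩
    exact ⟨f y, ⟨y, hy, rfl⟩, rfl⟩
  exists_isOpen := by
    obtain ⟨U, h1, h2, h3, h4⟩ := hf.exists_isOpen
    exact ⟨U, h1, h2, h3, fun x hx => (h4 x hx).mono fun y hy => congrArg h hy⟩
  measurableSet_preimage s := hf.measurableSet_preimage (h ⁻¹' s)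

theorem TypeIAt.comp_continuous {ν' : Measure Y} {π : X → Y} {f : Y → E}
    (hf : TypeIAt ν' (π x₀) f) (hπ : Continuous π) (hπ' : Measure.QuasiMeasurePreserving π ν ν') :
    TypeIAt ν x₀ fun x => f (π x) where
  exists_finite_image x := by
    obtain ⟨V, hV, hVf⟩ := hf.exists_finite_image (π x)
    refine ⟨π ⁻¹' V, hπ.continuousAt hV, hVf.subset ?_⟩
    rintro _ ⟨y, hy, rfl⟩
    exact ⟨π y, hy, rfl⟩
  exists_isOpen := by
    obtain ⟨U, h1, h2, h3, h4⟩ := hf.exists_isOpen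
    exact ⟨π ⁻¹' U, h1.preimage hπ, h2, hπ'.preimage_null h3,
      fun x hx => hπ.continuousAt.eventually (h4 _ hx)⟩
  measurableSet_preimage s := hπ'.measurable (hf.measurableSet_preimage s)

/-- Gluing can destroy local constancy only on the frontier, which must therefore be null and avoid
`x₀`. -/
theorem TypeIAt.piecewise {U : Set X} (hU : IsOpen U) (hU' : ν (frontier U) = 0) [OpensMeasurableSpace X]
    [DecidablePred (· ∈ U)] {g : X → E} (hf : TypeIAt ν x₀ f) (hg : TypeIAt ν x₀ g)
    (hx₀ : x₀ ∉ frontier U) : TypeIAt ν x₀ (U.piecewise f g) where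
  exists_finite_image x := by
    obtain ⟨V, hV, hVf⟩ := hf.exists_finite_image x
    obtain ⟨V', hV', hVf'⟩ := hg.exists_finite_image x
    refine ⟨V ∩ V', inter_mem hV hV', (hVf.union hVf').subset ?_⟩
    rintro _ ⟨y, hy, rfl⟩
    by_cases hyU : y ∈ U
    · rw [Set.piecewise_eq_of_mem _ _ _ hyU]
      exact .inl ⟨y, hy.1, rfl⟩
    · rw [Set.piecewise_eq_of_notMem _ _ _ hyU]
      exact .inr ⟨y, hy.2, rfl⟩
  exists_isOpen := by
    obtain ⟨U₁, h1, h2, h3, h4⟩ := hf.exists_isOpen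
    obtain ⟨U₂, h1', h2', h3', h4'⟩ := hg.exists_isOpen
    refine ⟨U₁ ∩ U₂ ∩ (frontier U)ᶜ, (h1.inter h1').inter isClosed_frontier.isOpen_compl,
      ⟨⟨h2, h2'⟩, hx₀⟩, ?_, fun x hx => ?_⟩
    · rw [Set.compl_inter, Set.compl_inter, compl_compl]
      exact measure_union_null (measure_union_null h3 h3') hU'
    · by_cases hxU : x ∈ U
      · filter_upwards [h4 x hx.1.1, hU.mem_nhds hxU] with y hy hyU
        rw [Set.piecewise_eq_of_mem _ _ _ hyU, Set.piecewise_eq_of_mem _ _ _ hxU, hy]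
      · have hxc : x ∉ closure U := fun h => hx.2 (by rw [hU.frontier_eq]; exact ⟨h, hxU⟩)
        filter_upwards [h4' x hx.1.2, isClosed_closure.isOpen_compl.mem_nhds hxc] with y hy hyU
        rw [Set.piecewise_eq_of_notMem _ _ _ fun h => hyU (subset_closure h),
          Set.piecewise_eq_of_notMem _ _ _ hxU, hy]
  measurableSet_preimage s := by
    rw [Set.piecewise_preimage]
    exact hU.measurableSet.ite (hf.measurableSet_preimage s) (hg.measurableSet_preimage s)

/-- A ball with a suitable small radius has null frontier, and a radius below `dist x₀ x` keeps `x₀`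
off the sphere when `x₀ ≠ x`. -/
theorem exists_isOpen_null_frontier [TopologicalSpace.MetrizableSpace X]
    [OpensMeasurableSpace X] (ν : Measure X) [SFinite ν] (x₀ : X) {x : X} {s : Set X}
    (hs : s ∈ 𝓝 x) : ∃ U ⊆ s, IsOpen U ∧ x ∈ U ∧ ν (frontier U) = 0 ∧ x₀ ∉ frontier U := by
  let := TopologicalSpace.metrizableSpaceMetric X
  obtain ⟨ε, hε, hεs⟩ := Metric.mem_nhds_iff.1 hs
  obtain ⟨δ, hδ, hδε, hδx⟩ : ∃ δ > 0, δ ≤ ε ∧ (x₀ ≠ x → δ ≤ dist x₀ x) := by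
    by_cases hx : x₀ = x
    · exact ⟨ε, hε, le_rfl, fun h => (h hx).elim⟩
    · exact ⟨min ε (dist x₀ x), lt_min hε (dist_pos.2 hx), min_le_left _ _,
        fun _ => min_le_right _ _⟩
  obtain ⟨r, hr, hr'⟩ := exists_null_frontier_thickening ν {x} hδ
  rw [Metric.thickening_singleton] at hr'
  refine ⟨Metric.ball x r, (Metric.ball_subset_ball (hr.2.le.trans hδε)).trans hεs,
    Metric.isOpen_ball, Metric.mem_ball_self hr.1, hr', fun h => ?_⟩
  have h' : dist x₀ x = r := Metric.frontier_ball_subset_sphere h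
  have hne : x₀ ≠ x := fun h0 => by
    rw [h0, dist_self] at h'
    exact hr.1.ne h'
  exact absurd (hδx hne) (by rw [h']; exact hr.2.not_ge)

/-- A relation that holds locally can be realised, on a compact set, by a type-I function. -/
theorem exists_typeIAt_of_eventually [TopologicalSpace.MetrizableSpace X]
    [OpensMeasurableSpace X] (ν : Measure X) [SFinite ν] (x₀ : X) {P : X → E → Prop}
    (h : ∀ x, ∃ a, ∀ᶠ y in 𝓝 x, P y a) {K : Set X} (hK : IsCompact K) :
    ∃ f : X → E, TypeIAt ν x₀ f ∧ ∀ x ∈ K, P x (f x) := by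
  classical
  -- The induction over compact sets carries an open set with a good frontier, along which two
  -- partial solutions can be glued.
  suffices ∃ U : Set X, IsOpen U ∧ ν (frontier U) = 0 ∧ x₀ ∉ frontier U ∧ K ⊆ U ∧
      ∃ f : X → E, TypeIAt ν x₀ f ∧ ∀ x ∈ U, P x (f x) by
    obtain ⟨U, -, -, -, hKU, f, hf, hfU⟩ := this
    exact ⟨f, hf, fun x hx => hfU x (hKU hx)⟩
  refine hK.induction_on ?_ ?_ ?_ ?_
  · obtain ⟨a, -⟩ := h x₀
    exact ⟨∅, isOpen_empty, by simp, by simp, le_rfl, fun _ => a, .const ν x₀ a, fun _ h => h.elim⟩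
  · rintro s t hst ⟨U, h1, h2, h3, h4, h5⟩
    exact ⟨U, h1, h2, h3, hst.trans h4, h5⟩
  · rintro s t ⟨U, h1, h2, h3, h4, f, hf, hfU⟩ ⟨V, k1, k2, k3, k4, g, hg, hgV⟩
    have hfr : frontier (U ∪ V) ⊆ frontier U ∪ frontier V :=
      (frontier_union_subset U V).trans
        (Set.union_subset_union Set.inter_subset_left Set.inter_subset_right)
    refine ⟨U ∪ V, h1.union k1, measure_mono_null hfr (measure_union_null h2 k2),
      fun h => (hfr h).elim h3 k3, Set.union_subset_union h4 k4, U.piecewise f g,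
      hf.piecewise h1 h2 hg h3, fun x hx => ?_⟩
    by_cases hxU : x ∈ U
    · rw [Set.piecewise_eq_of_mem _ _ _ hxU]
      exact hfU x hxU
    · rw [Set.piecewise_eq_of_notMem _ _ _ hxU]
      exact hgV x (hx.resolve_left hxU)
  · intro x _
    obtain ⟨a, ha⟩ := h x
    obtain ⟨U, hU, h1, h2, h3, h4⟩ := exists_isOpen_null_frontier ν x₀ ha
    exact ⟨U, mem_nhdsWithin_of_mem_nhds (h1.mem_nhds h2), U, h1, h3, h4, le_rfl, fun _ => a,
      .const ν x₀ a, fun y hy => hU hy⟩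

end TypeIAt

/-! ### Locally uniform limits of type-I functions: twisting and lifting -/

section NiceAt

variable {X Y : Type*} [TopologicalSpace X] [MeasurableSpace X] [TopologicalSpace Y]
  [MeasurableSpace Y] {E F : Type*} [AddCommGroup E] [AddCommGroup F]

/-- Locally uniform limits, with respect to the chain `W`, of Borel type-I functions that are
locally constant around `x₀`. -/
def NiceAt (W : ℕ → Set E) (ν : Measure X) (x₀ : X) (f : X → E) : Prop :=
  ∃ γ : ℕ → X → E, (∀ n, TypeIAt ν x₀ (γ n)) ∧
    ∀ K : Set X, IsCompact K → ∀ j, ∀ᶠ n in atTop, ∀ x ∈ K, γ n x - f x ∈ W j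

variable {W : ℕ → Set E} {W' : ℕ → Set F} {ν : Measure X} {x₀ : X} {f g : X → E}

theorem NiceAt.const (hW : IsAddChain W) (ν : Measure X) (x₀ : X) (a : E) :
    NiceAt W ν x₀ fun _ => a :=
  ⟨fun _ _ => a, fun _ => .const ν x₀ a, fun K _ j => Eventually.of_forall fun n x _ => by
    simpa using hW.zero_mem j⟩

theorem NiceAt.add [SigmaCompactSpace X] (hW : IsAddChain W) (hf : NiceAt W ν x₀ f)
    (hg : NiceAt W ν x₀ g) : NiceAt W ν x₀ fun x => f x + g x := by
  obtain ⟨γ, h1, h2⟩ := hf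
  obtain ⟨δ, k1, k2⟩ := hg
  refine ⟨fun n x => γ n x + δ n x, fun n => (h1 n).map₂ (k1 n) (· + ·), fun K hK j => ?_⟩
  filter_upwards [h2 K hK (j + 1), k2 K hK (j + 1)] with n hn hn' x hx
  rw [add_sub_add_comm]
  exact hW.add_mem j _ (hn x hx) _ (hn' x hx)

theorem NiceAt.neg (hW : IsAddChain W) (hf : NiceAt W ν x₀ f) : NiceAt W ν x₀ fun x => -f x := by
  obtain ⟨γ, h1, h2⟩ := hf
  refine ⟨fun n x => -γ n x, fun n => (h1 n).map (- ·), fun K hK j => ?_⟩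
  filter_upwards [h2 K hK j] with n hn x hx
  rw [← neg_sub']
  exact hW.neg_mem j _ (hn x hx)

theorem NiceAt.neg_one_pow_smul (hW : IsAddChain W) (hf : NiceAt W ν x₀ f) (k : ℕ) :
    NiceAt W ν x₀ fun x => (-1 : ℤ) ^ k • f x := by
  rcases neg_one_pow_eq_or ℤ k with h | h
  · simpa [h] using hf
  · simpa [h] using hf.neg hW

theorem NiceAt.sum [SigmaCompactSpace X] (hW : IsAddChain W) {ι : Type*} (s : Finset ι)
    {f : ι → X → E} (hf : ∀ i, NiceAt W ν x₀ (f i)) : NiceAt W ν x₀ fun x => ∑ i ∈ s, f i x := by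
  classical
  induction s using Finset.induction_on with
  | empty => simpa using NiceAt.const hW ν x₀ 0
  | insert a s ha ih =>
    simp only [Finset.sum_insert ha]
    exact (hf a).add hW ih

theorem NiceAt.comp_continuous {ν' : Measure Y} {π : X → Y} {f : Y → E}
    (hf : NiceAt W ν' (π x₀) f) (hπ : Continuous π) (hπ' : Measure.QuasiMeasurePreserving π ν ν') :
    NiceAt W ν x₀ fun x => f (π x) := by
  obtain ⟨γ, h1, h2⟩ := hf
  refine ⟨fun n x => γ n (π x), fun n => (h1 n).comp_continuous hπ hπ', fun K hK j => ?_⟩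
  filter_upwards [h2 (π '' K) (hK.image hπ) j] with n hn x hx
  exact hn _ ⟨x, hx, rfl⟩

/-- The approximation can be made as fast as desired on a given exhaustion by compact sets. -/
theorem NiceAt.exists_rapid (hf : NiceAt W ν x₀ f) (C : CompactExhaustion X)
    (J : ℕ → ℕ) : ∃ γ : ℕ → X → E, (∀ n, TypeIAt ν x₀ (γ n)) ∧
      ∀ n, ∀ x ∈ C n, γ n x - f x ∈ W (J n) := by
  obtain ⟨γ, h1, h2⟩ := hf
  choose m hm using fun n => (h2 (C n) (C.isCompact n) (J n)).exists
  exact ⟨fun n => γ (m n), fun n => h1 _, hm⟩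

theorem NiceAt.of_rapid (hW : IsAddChain W) (C : CompactExhaustion X) {γ : ℕ → X → E}
    (h1 : ∀ n, TypeIAt ν x₀ (γ n)) (h2 : ∀ n, ∀ x ∈ C n, γ n x - f x ∈ W n) : NiceAt W ν x₀ f := by
  refine ⟨γ, h1, fun K hK j => ?_⟩
  obtain ⟨N, hN⟩ := C.exists_superset_of_isCompact hK
  filter_upwards [eventually_ge_atTop (max N j)] with n hn x hx
  exact hW.antitone ((le_max_right _ _).trans hn)
    (h2 n x (C.subset ((le_max_left _ _).trans hn) (hN hx)))

/-- Twisting by a continuous action preserves the class of locally uniform limits of type-I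
functions. -/
theorem NiceAt.twist {G : Type*} [TopologicalSpace G] [MeasurableSpace G]
    [TopologicalSpace.MetrizableSpace G] [OpensMeasurableSpace G] {μ : Measure G} [SFinite μ]
    [SigmaCompactSpace X] [WeaklyLocallyCompactSpace X]
    (hW : IsAddChain W) (ρ : G → E →+ E)
    (hsmall : ∀ K : Set G, IsCompact K → ∀ n, ∃ j, ∀ g ∈ K, ∀ a ∈ W j, ρ g a ∈ W n)
    (horbit : ∀ a n g₀, ∀ᶠ g in 𝓝 g₀, ρ g a - ρ g₀ a ∈ W n)
    {ν' : Measure Y} {π : X → Y} {θ : X → G} {f : Y → E} (hf : NiceAt W ν' (π x₀) f)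
    (hπ : Continuous π) (hπ' : Measure.QuasiMeasurePreserving π ν ν')
    (hθ : Continuous θ) (hθ' : Measure.QuasiMeasurePreserving θ ν μ) :
    NiceAt W ν x₀ fun x => ρ (θ x) (f (π x)) := by
  obtain ⟨γ, h1, h2⟩ := hf
  let C : CompactExhaustion X := default
  -- On `C n` the function `γ n ∘ π` has finitely many values, so one type-I step function `c` of
  -- the group variable can serve all their orbit maps at once. The total error is then that of `c`
  -- plus `ρ (θ x)` applied to the error of `γ n`.
  have hc : ∀ n, ∃ c : G → G, TypeIAt μ (θ x₀) c ∧
      ∀ g ∈ θ '' C n, ∀ a ∈ γ n '' (π '' C n), ρ g a - ρ (c g) a ∈ W n := fun n =>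
    exists_typeIAt_of_eventually μ (θ x₀)
      (fun g₀ => ⟨g₀, (((h1 n).finite_image ((C.isCompact n).image hπ)).eventually_all).2
        fun a _ => horbit a n g₀⟩) ((C.isCompact n).image hθ)
  choose c hc1 hc2 using hc
  refine ⟨fun n x => ρ (c n (θ x)) (γ n (π x)), fun n =>
    ((hc1 n).comp_continuous hθ hθ').map₂ ((h1 n).comp_continuous hπ hπ') fun g a => ρ g a,
    fun K hK j => ?_⟩
  obtain ⟨N, hN⟩ := C.exists_superset_of_isCompact hK
  obtain ⟨i, hi⟩ := hsmall (θ '' K) (hK.image hθ) (j + 1)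
  filter_upwards [eventually_ge_atTop (max N (j + 1)), h2 (π '' K) (hK.image hπ) i] with n hn hn' x hx
  have hxC : x ∈ C n := C.subset ((le_max_left _ _).trans hn) (hN hx)
  have e1 := hc2 n (θ x) ⟨x, hxC, rfl⟩ (γ n (π x)) ⟨_, ⟨x, hxC, rfl⟩, rfl⟩
  have e2 := hi (θ x) ⟨x, hx, rfl⟩ _ (hn' _ ⟨x, hx, rfl⟩)
  have e3 := hW.add_mem j _ (hW.antitone ((le_max_right _ _).trans hn) (hW.neg_mem _ _ e1)) _ e2
  convert e3 using 1
  rw [map_sub]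
  abel

/-- Lifting through a homomorphism that is open onto a subgroup. -/
theorem NiceAt.exists_lift [SigmaCompactSpace X] [WeaklyLocallyCompactSpace X]
    (hW : IsAddChain W) (hW' : IsAddChain W') (q : E →+ F) (B : AddSubgroup F)
    (hsurj : ∀ b ∈ B, ∃ a, q a = b)
    (hopen : ∀ n, ∃ j, ∀ b ∈ B, b ∈ W' j → ∃ a ∈ W n, q a = b)
    (hcomplete : ∀ (a : ℕ → E) (N : ℕ), (∀ n, N ≤ n → a n ∈ W n) →
      ∃ s, ∀ n, N ≤ n → ∑ i ∈ Finset.range (n + 3), a i - s ∈ W n)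
    (hclosed : ∀ (e : ℕ → E) (s : E) (b : F) (N : ℕ), (∀ n, N ≤ n → e n - s ∈ W n) →
      (∀ n, N ≤ n → q (e n) - b ∈ W' n) → q s = b)
    {b : X → F} (hb : NiceAt W' ν x₀ b) (hbB : ∀ x, b x ∈ B) :
    ∃ u : X → E, NiceAt W ν x₀ u ∧ ∀ x, q (u x) = b x := by
  classical
  let C : CompactExhaustion X := default
  choose j hj using hopen
  -- Monotone and above both `n` and `j n`. Approximation to order `J n + 2` leaves order `J n + 1`
  -- after rounding into `B`, and order `J n` for differences of successive approximants.
  let J : ℕ → ℕ := fun n => n + ∑ i ∈ Finset.range (n + 1), j i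
  have hJ : Monotone J := fun m n hmn => Nat.add_le_add hmn
    (Finset.sum_le_sum_of_subset (Finset.range_subset_range.2 (by omega)))
  have hJj : ∀ n, j n ≤ J n := fun n =>
    (Finset.single_le_sum (f := j) (fun _ _ => Nat.zero_le _)
      (Finset.self_mem_range_succ n)).trans (Nat.le_add_left _ _)
  have hJn : ∀ n, n ≤ J n := fun n => Nat.le_add_right _ _
  obtain ⟨γ, h1, h2⟩ := hb.exists_rapid C fun n => J n + 2
  -- Rounding into `B`. It depends on the value alone, so it preserves type I; the default `0` keeps
  -- all its values in `B`.
  let χ : ℕ → F → F := fun n a => if h : ∃ b ∈ B, a - b ∈ W' (J n + 2) then h.choose else 0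
  have hχB : ∀ n a, χ n a ∈ B := by
    intro n a
    by_cases h : ∃ b ∈ B, a - b ∈ W' (J n + 2)
    · simpa only [χ, dif_pos h] using h.choose_spec.1
    · simpa only [χ, dif_neg h] using B.zero_mem
  let c : ℕ → X → F := fun n x => χ n (γ n x)
  have hc : ∀ n, TypeIAt ν x₀ (c n) := fun n => (h1 n).map (χ n)
  have hcb : ∀ n, ∀ x ∈ C n, c n x - b x ∈ W' (J n + 1) := by
    intro n x hx
    have h : ∃ b ∈ B, γ n x - b ∈ W' (J n + 2) := ⟨b x, hbB x, h2 n x hx⟩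
    have h' : γ n x - c n x ∈ W' (J n + 2) := by
      simpa only [c, χ, dif_pos h] using h.choose_spec.2
    simpa using hW'.sub_mem (h2 n x hx) h'
  have hcc : ∀ n, ∀ x ∈ C n, c (n + 1) x - c n x ∈ W' (j n) := by
    intro n x hx
    have e1 := hW'.antitone (Nat.add_le_add_right (hJ n.le_succ) 1)
      (hcb (n + 1) x (C.subset n.le_succ hx))
    have e2 := hW'.sub_mem e1 (hcb n x hx)
    exact hW'.antitone (hJj n) (by simpa using e2)
  -- A section of `q` over `B` that picks a lift in `W n` whenever there is one.
  let l : ℕ → F → E := fun n δ => if h : ∃ a ∈ W n, q a = δ then h.choose else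
    if h' : ∃ a, q a = δ then h'.choose else 0
  have hl : ∀ n, ∀ δ ∈ B, q (l n δ) = δ := by
    intro n δ hδ
    by_cases h : ∃ a ∈ W n, q a = δ
    · simpa only [l, dif_pos h] using h.choose_spec.2
    · simpa only [l, dif_neg h, dif_pos (hsurj δ hδ)] using (hsurj δ hδ).choose_spec
  have hlW : ∀ n, ∀ δ ∈ B, δ ∈ W' (j n) → l n δ ∈ W n := by
    intro n δ hδ hδ'
    have h : ∃ a ∈ W n, q a = δ := hj n δ hδ hδ'
    simpa only [l, dif_pos h] using h.choose_spec.1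
  let t : ℕ → X → E := fun n x => l n (c (n + 1) x - c n x)
  have ht : ∀ n, TypeIAt ν x₀ (t n) := fun n => (hc (n + 1)).map₂ (hc n) fun a b => l n (a - b)
  -- Lifted increments telescope under `q`, so that `S n` lifts `c n`.
  let S : ℕ → X → E := fun n x => l 0 (c 0 x) + ∑ i ∈ Finset.range n, t i x
  have hS : ∀ n, TypeIAt ν x₀ (S n) := by
    intro n
    induction n with
    | zero => simpa [S] using (hc 0).map (l 0)
    | succ n ih => simpa only [S, Finset.sum_range_succ, ← add_assoc] using ih.map₂ (ht n) (· + ·)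
  have hqS : ∀ n x, q (S n x) = c n x := by
    intro n x
    induction n with
    | zero => simpa [S] using hl 0 _ (hχB _ _)
    | succ n ih =>
      have e : S (n + 1) x = S n x + t n x := by
        simp only [S, Finset.sum_range_succ, add_assoc]
      rw [e, map_add, ih, hl n _ (B.sub_mem (hχB _ _) (hχB _ _))]
      abel
  have hs : ∀ x, ∃ s, ∀ n, x ∈ C n → S (n + 3) x - s ∈ W n := by
    intro x
    -- Starting from the first compact set that contains `x` makes one limit `s` serve every `n`
    -- with `x ∈ C n`.
    obtain ⟨N, hN⟩ : ∃ N, x ∈ C N ∧ ∀ n, x ∈ C n → N ≤ n :=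
      ⟨Nat.find (C.exists_mem x), Nat.find_spec (C.exists_mem x), fun n hn => Nat.find_min' _ hn⟩
    obtain ⟨s, hs⟩ := hcomplete (fun n => t n x) N fun n hn =>
      hlW n _ (B.sub_mem (hχB _ _) (hχB _ _)) (hcc n x (C.subset hn hN.1))
    refine ⟨l 0 (c 0 x) + s, fun n hn => ?_⟩
    simpa [S] using hs n (hN.2 n hn)
  choose u hu using hs
  refine ⟨u, .of_rapid hW C (fun n => hS (n + 3)) fun n x hx => hu x n hx, fun x => ?_⟩
  obtain ⟨N, hN⟩ := C.exists_mem x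
  refine hclosed (fun n => S (n + 3) x) _ _ N (fun n hn => hu x n (C.subset hn hN)) fun n hn => ?_
  rw [hqS]
  exact hW'.antitone ((hJn n).trans ((hJ (by omega)).trans (Nat.le_succ _)))
    (hcb (n + 3) x (C.subset (by omega) hN))

end NiceAt
end MooreCohomology

/-! ### Convergence in measure and openness of the differential -/

namespace MooreCohomology

open scoped ENNReal

set_option linter.unusedSectionVars false

/-- The contracting homotopy: where the left side vanishes, freezing the last variable of `f` at `t`
gives a primitive of `f`. -/
theorem dFun_insertNth_last {G A : Type*} [AddCommGroup A] {m : ℕ} (f : (Fin (m + 1) → G) → A)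
    (t : G) (y : Fin (m + 1) → G) :
    dFun f (Fin.insertNth (α := fun _ => G) (Fin.last (m + 1)) t y) =
      f y - dFun (fun y' => f (Fin.insertNth (α := fun _ => G) (Fin.last m) t y')) y := by
  unfold dFun
  rw [Fin.sum_univ_castSucc, add_comm, sub_eq_add_neg, ← Finset.sum_neg_distrib]
  congr 1
  · simp
  · refine Finset.sum_congr rfl fun i _ => ?_
    have hi := i.2
    have h1 : m + 1 - ((i.castSucc : Fin (m + 2)) : ℕ) = m - (i : ℕ) + 1 := by
      simp only [Fin.val_castSucc]
      omega
    have h2 : i.castSucc.removeNth (Fin.insertNth (α := fun _ => G) (Fin.last (m + 1)) t y) =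
        Fin.insertNth (α := fun _ => G) (Fin.last m) t (i.removeNth y) := by
      rw [Fin.insertNth_last', Fin.insertNth_last']
      ext k
      induction k using Fin.lastCases with
      | last =>
        rw [Fin.removeNth_apply, Fin.succAbove_ne_last_last (Fin.castSucc_lt_last i).ne,
          Fin.snoc_last, Fin.snoc_last]
      | cast k =>
        rw [Fin.removeNth_apply, Fin.castSucc_succAbove_castSucc, Fin.snoc_castSucc,
          Fin.snoc_castSucc, Fin.removeNth_apply]
    rw [h1, h2, pow_succ, mul_neg_one, neg_smul]

theorem ae_insertNth {G : Type*} [MeasurableSpace G] (μ : Measure G) [SigmaFinite μ] {m : ℕ}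
    (i : Fin (m + 1)) {P : (Fin (m + 1) → G) → Prop} (h : ∀ᵐ z ∂powMeasure μ (m + 1), P z) :
    ∀ᵐ t ∂μ, ∀ᵐ y ∂powMeasure μ m, P (Fin.insertNth (α := fun _ => G) i t y) :=
  Measure.ae_ae_of_ae_prod
    ((measurePreserving_piFinSuccAbove (fun _ => μ) i).symm.quasiMeasurePreserving.ae h)

theorem tsum_geometric_two_add (n : ℕ) : ∑' k : ℕ, (2⁻¹ : ℝ≥0∞) ^ (k + (n + 1)) = 2⁻¹ ^ n := by
  simp_rw [pow_add _ _ (n + 1)]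
  rw [ENNReal.tsum_mul_right, ENNReal.tsum_geometric, ENNReal.one_sub_inv_two, inv_inv, pow_succ',
    ← mul_assoc, ENNReal.mul_inv_cancel two_ne_zero ENNReal.ofNat_ne_top, one_mul]

section SmallSet

variable {G : Type*} [Group G] [TopologicalSpace G] [IsTopologicalGroup G]
  [LocallyCompactSpace G] [SecondCountableTopology G] [T2Space G]
  [MeasurableSpace G] [BorelSpace G] {μ : Measure G} [μ.IsHaarMeasure]
  {A : Type*} [AddCommGroup A] [TopologicalSpace A] [IsTopologicalAddGroup A]

/-- The classes that take values in `V n` on the `m`-th power of the `n`-th compact set of the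
exhaustion `C`, up to a set of measure at most `2⁻ⁿ`. -/
def smallSet (μ : Measure G) (C : CompactExhaustion G) (V : ℕ → Set A) (m n : ℕ) :
    Set (Cochain μ A m) :=
  {φ | powMeasure μ m {y | (∀ i, y i ∈ C n) ∧ φ y ∉ V n} ≤ 2⁻¹ ^ n}

variable {C : CompactExhaustion G} {V : ℕ → Set A} {m : ℕ}

theorem mem_smallSet_of_ae_imp {n : ℕ} {φ : Cochain μ A m} {E : Set (Fin m → G)}
    (hE : powMeasure μ m E ≤ 2⁻¹ ^ n)
    (h : ∀ᵐ y ∂powMeasure μ m, (∀ i, y i ∈ C n) → y ∉ E → φ y ∈ V n) : φ ∈ smallSet μ C V m n := by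
  refine (measure_mono_ae ?_).trans hE
  filter_upwards [h] with y hy hy'
  by_contra hyE
  exact hy'.2 (hy hy'.1 hyE)

theorem isAddChain_smallSet (hV : IsAddChain V) : IsAddChain (smallSet μ C V m) where
  zero_mem n := mem_smallSet_of_ae_imp (E := ∅) (by simp) (by
    filter_upwards [AEEqFun.coeFn_zero (μ := powMeasure μ m) (α := Fin m → G) (β := A)] with y hy _ _
    rw [hy]
    exact hV.zero_mem n)
  neg_mem n φ hφ := mem_smallSet_of_ae_imp hφ (by
    filter_upwards [AEEqFun.coeFn_neg φ] with y hy hy1 hy2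
    rw [hy]
    exact hV.neg_mem n _ (not_not.1 fun h => hy2 ⟨hy1, h⟩))
  add_mem n φ hφ ψ hψ := by
    refine mem_smallSet_of_ae_imp (E := _ ∪ _) ((measure_union_le _ _).trans
      ((add_le_add hφ hψ).trans_eq ?_)) ?_
    · rw [← two_mul, pow_succ', ← mul_assoc, ENNReal.mul_inv_cancel two_ne_zero
        ENNReal.ofNat_ne_top, one_mul]
    · filter_upwards [AEEqFun.coeFn_add φ ψ] with y hy hy1 hy2
      rw [hy]
      have hy3 : ∀ i, y i ∈ C (n + 1) := fun i => C.subset n.le_succ (hy1 i)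
      exact hV.add_mem n _ (not_not.1 fun h => hy2 (.inl ⟨hy3, h⟩)) _
        (not_not.1 fun h => hy2 (.inr ⟨hy3, h⟩))

/-- Borel–Cantelli: the exceptional sets have summable measures, and every tuple eventually lies in
the compact cubes. -/
theorem ae_eventually_mem {a : ℕ → Cochain μ A m} {N : ℕ}
    (ha : ∀ n, N ≤ n → a n ∈ smallSet μ C V m n) :
    ∀ᵐ y ∂powMeasure μ m, ∀ᶠ n in atTop, a n y ∈ V n := by
  have h := ae_eventually_notMem (μ := powMeasure μ m)
    (s := fun n => {y | (∀ i, y i ∈ C (n + N)) ∧ a (n + N) y ∉ V (n + N)}) (by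
      refine ne_top_of_le_ne_top ?_ (ENNReal.tsum_le_tsum fun n => ha (n + N) (by omega))
      refine ne_top_of_le_ne_top (b := ∑' k : ℕ, (2⁻¹ : ℝ≥0∞) ^ k) ?_
        (ENNReal.tsum_le_tsum fun n => ?_)
      · rw [ENNReal.tsum_geometric, ENNReal.one_sub_inv_two, inv_inv]
        exact ENNReal.ofNat_ne_top
      · exact pow_le_pow_right_of_le_one' (by simp) (by omega))
  filter_upwards [h] with y hy
  have hC : ∀ᶠ n in atTop, ∀ i, y i ∈ C n := eventually_all.2 fun i => by
    obtain ⟨M, hM⟩ := C.exists_mem (y i)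
    exact (eventually_ge_atTop M).mono fun n hn => C.subset hn hM
  obtain ⟨M, hM⟩ := eventually_atTop.1 hy
  filter_upwards [eventually_ge_atTop (M + N), hC] with n h1 h2
  have h3 := hM (n - N) (by omega)
  rw [Nat.sub_add_cancel (by omega)] at h3
  exact not_not.1 fun h4 => h3 ⟨h2, h4⟩

theorem tendsto_ae_of_mem_smallSet (hV : IsNhdsChain V) {e : ℕ → Cochain μ A m}
    {s : Cochain μ A m} {N : ℕ} (h : ∀ n, N ≤ n → e n - s ∈ smallSet μ C V m n) :
    ∀ᵐ y ∂powMeasure μ m, Tendsto (fun n => e n y) atTop (𝓝 (s y)) := by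
  have h' : ∀ᵐ y ∂powMeasure μ m, ∀ n, (e n - s) y = e n y - s y :=
    ae_all_iff.2 fun n => AEEqFun.coeFn_sub _ _
  filter_upwards [ae_eventually_mem h, h'] with y hy hy'
  rw [hV.tendsto_iff]
  intro k
  filter_upwards [hy, eventually_ge_atTop k] with n hn hkn
  rw [← hy']
  exact hV.antitone hkn hn

theorem coeFn_sum {ι : Type*} (s : Finset ι) (a : ι → Cochain μ A m) :
    (↑(∑ i ∈ s, a i) : (Fin m → G) → A) =ᵐ[powMeasure μ m] fun y => ∑ i ∈ s, a i y := by
  classical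
  induction s using Finset.induction_on with
  | empty =>
    simp only [Finset.sum_empty]
    exact AEEqFun.coeFn_zero
  | insert i s hi ih =>
    simp only [Finset.sum_insert hi]
    exact (AEEqFun.coeFn_add _ _).trans (ih.mono fun y hy => by simp [hy])

/-- Completeness of `C(G^m, A)`. The sum converges almost everywhere, and its remainder is
controlled off the exceptional sets of index at least `n + 1`, of total measure at most `2^-n`. The
offset `3` leaves room for the indices lost in summing and in passing to the limit. -/
theorem exists_sum_smallSet [PolishSpace A] (hV : IsNhdsChain V) (a : ℕ → Cochain μ A m) (N : ℕ)
    (ha : ∀ n, N ≤ n → a n ∈ smallSet μ C V m n) :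
    ∃ s, ∀ n, N ≤ n → ∑ i ∈ Finset.range (n + 3), a i - s ∈ smallSet μ C V m n := by
  have hconv : ∀ᵐ y ∂powMeasure μ m, ∃ b, Tendsto (fun n => ∑ i ∈ Finset.range n, a i y) atTop
      (𝓝 b) := by
    filter_upwards [ae_eventually_mem ha] with y hy
    obtain ⟨M, hM⟩ := eventually_atTop.1 hy
    exact hV.exists_tendsto_sum hM
  obtain ⟨f, hf, hfl⟩ := exists_stronglyMeasurable_limit_of_tendsto_ae
    (fun n => Finset.aestronglyMeasurable_fun_sum (Finset.range n)
      fun i _ => (a i).aestronglyMeasurable) hconv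
  refine ⟨AEEqFun.mk f hf.aestronglyMeasurable, fun n hn => ?_⟩
  refine mem_smallSet_of_ae_imp (E := ⋃ k : ℕ, {y | (∀ i, y i ∈ C (k + (n + 1))) ∧
    a (k + (n + 1)) y ∉ V (k + (n + 1))}) ((measure_iUnion_le _).trans
      ((ENNReal.tsum_le_tsum fun k => ha _ (by omega)).trans_eq (tsum_geometric_two_add n))) ?_
  filter_upwards [AEEqFun.coeFn_sub (∑ i ∈ Finset.range (n + 3), a i)
    (AEEqFun.mk f hf.aestronglyMeasurable), AEEqFun.coeFn_mk f hf.aestronglyMeasurable,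
    coeFn_sum (Finset.range (n + 3)) a, hfl] with y h1 h2 h3 h4 h5 h6
  rw [h1, Pi.sub_apply, h2, h3, ← neg_sub]
  refine hV.neg_mem n _ ?_
  refine hV.mem_of_tendsto (h4.sub_const _) ?_
  filter_upwards [eventually_ge_atTop (n + 3)] with M hM
  rw [← Finset.sum_Ico_eq_sub _ hM]
  refine hV.antitone (by omega : n + 1 ≤ n + 2) (hV.sum_mem (n + 2) M fun k hk _ => ?_)
  refine not_not.1 fun h => h6 (Set.mem_iUnion.2 ⟨k - (n + 1), ?_⟩)
  rw [Nat.sub_add_cancel (by omega)]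
  exact ⟨fun i => C.subset (by omega) (h5 i), h⟩

/-- The graph of `d` is closed: both convergences hold almost everywhere, and face maps pull null
sets back to null sets. -/
theorem d_eq_of_mem_smallSet [T2Space A] (hV : IsNhdsChain V) (e : ℕ → Cochain μ A m)
    (s : Cochain μ A m) (b : Cochain μ A (m + 1)) (N : ℕ)
    (h1 : ∀ n, N ≤ n → e n - s ∈ smallSet μ C V m n)
    (h2 : ∀ n, N ≤ n → d μ A m (e n) - b ∈ smallSet μ C V (m + 1) n) : d μ A m s = b := by
  refine AEEqFun.ext ?_
  have h3 : ∀ᵐ y ∂powMeasure μ (m + 1), ∀ i : Fin (m + 1),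
      Tendsto (fun n => e n (i.removeNth y)) atTop (𝓝 (s (i.removeNth y))) :=
    ae_all_iff.2 fun i => (quasiMeasurePreserving_removeNth μ i).ae
      (tendsto_ae_of_mem_smallSet hV h1)
  have h4 : ∀ᵐ y ∂powMeasure μ (m + 1), ∀ n, d μ A m (e n) y = dFun (e n) y :=
    ae_all_iff.2 fun n => coeFn_d μ A _
  filter_upwards [h3, h4, tendsto_ae_of_mem_smallSet hV h2, coeFn_d μ A s] with y k3 k4 k5 k6
  rw [k6]
  refine tendsto_nhds_unique ?_ k5
  simp only [k4]
  exact tendsto_finsetSum _ fun i _ => (k3 i).const_smul _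

/-- The primitive is a slice of `φ` at a frozen last variable `t`. By Fubini almost every `t` gives
a primitive; if `φ` is small, Markov's inequality leaves some such `t` in `C k` whose slice is
small. -/
theorem exists_d_eq [PolishSpace A] (hV : IsNhdsChain V) (n : ℕ) :
    ∃ j, ∀ φ : Cochain μ A (m + 1), d μ A (m + 1) φ = 0 → ∃ ψ : Cochain μ A m, d μ A m ψ = φ ∧
      (φ ∈ smallSet μ C V (m + 1) j → ψ ∈ smallSet μ C V m n) := by
  borelize A
  obtain ⟨k, hk⟩ : ∃ k, μ (C k) ≠ 0 := by
    by_contra! h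
    have := measure_iUnion_null h
    rw [C.iUnion_eq] at this
    exact (NeZero.ne μ) (Measure.measure_univ_eq_zero.1 this)
  obtain ⟨l, hl⟩ : ∃ l : ℕ, (2⁻¹ : ℝ≥0∞) ^ l < μ (C k) := by
    obtain ⟨l, hl⟩ := ENNReal.exists_inv_two_pow_lt hk
    exact ⟨l, hl⟩
  -- The `t` with exceptional slice of measure at least `2^-n` form a set of measure at most
  -- `2^-(l+k)`, less than `μ (C k)`. The index also dominates `n` and `k`, which places `C n` and
  -- `C k` inside the compact set used for `φ`.
  refine ⟨l + n + k, fun φ hφ => ?_⟩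
  have hφm : StronglyMeasurable φ := φ.stronglyMeasurable
  have hins : ∀ t : G, Measurable fun y : Fin m → G =>
      Fin.insertNth (α := fun _ => G) (Fin.last m) t y := fun t =>
    (MeasurableEquiv.piFinSuccAbove (fun _ => G) (Fin.last m)).symm.measurable.comp
      measurable_prodMk_left
  have hd0 : ∀ᵐ z ∂powMeasure μ (m + 2), dFun φ z = 0 := by
    filter_upwards [coeFn_d μ A φ, AEEqFun.coeFn_zero (μ := powMeasure μ (m + 2))
      (α := Fin (m + 2) → G) (β := A)] with z h1 h2
    rw [← h1, hφ, h2]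
    rfl
  obtain ⟨t, ht1, ht2⟩ : ∃ t, (∀ᵐ y ∂powMeasure μ (m + 1),
        dFun φ (Fin.insertNth (α := fun _ => G) (Fin.last (m + 1)) t y) = 0) ∧
      (φ ∈ smallSet μ C V (m + 1) (l + n + k) →
        powMeasure μ m {y | (∀ i, y i ∈ C n) ∧
          φ (Fin.insertNth (α := fun _ => G) (Fin.last m) t y) ∉ V n} ≤ 2⁻¹ ^ n) := by
    have hae := ae_insertNth μ (Fin.last (m + 1)) hd0
    by_cases hsm : φ ∈ smallSet μ C V (m + 1) (l + n + k)
    · let Z : Set (Fin (m + 1) → G) :=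
        {z | (∀ i, z i ∈ C (l + n + k)) ∧ φ z ∉ V (l + n + k)}
      have hZ : MeasurableSet Z := by
        have h1 : MeasurableSet {z : Fin (m + 1) → G | ∀ i, z i ∈ C (l + n + k)} := by
          have := (isClosed_set_pi (s := fun _ : Fin (m + 1) => C (l + n + k)) (i := Set.univ)
            fun i _ => C.isClosed (l + n + k)).measurableSet
          simpa only [Set.pi, Set.mem_univ, true_imp_iff] using this
        exact h1.inter (hφm.measurable (hV.isOpen _).measurableSet).compl
      let g : G → ℝ≥0∞ := fun t => powMeasure μ m
        {y | Fin.insertNth (α := fun _ => G) (Fin.last m) t y ∈ Z}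
      have hmp := (measurePreserving_piFinSuccAbove (fun _ => μ) (Fin.last m)).symm
      have hZ' := hmp.measurable hZ
      have hg : Measurable g := measurable_measure_prodMk_left hZ'
      have hgZ : ∫⁻ t, g t ∂μ ≤ 2⁻¹ ^ (l + n + k) := by
        refine le_trans (le_of_eq ?_) hsm
        exact ((Measure.prod_apply hZ').symm.trans (hmp.measure_preimage hZ.nullMeasurableSet))
      have hB : μ {t | 2⁻¹ ^ n ≤ g t} < μ (C k) := by
        refine lt_of_le_of_lt ?_ hl
        refine (meas_ge_le_lintegral_div hg.aemeasurable (by simp) (by simp)).trans ?_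
        refine ENNReal.div_le_of_le_mul (hgZ.trans ?_)
        rw [← pow_add]
        exact pow_le_pow_right_of_le_one' (by simp) (by omega)
      by_contra! hcon
      refine hB.not_ge (measure_mono_ae ?_)
      filter_upwards [hae] with t ht htC
      refine (hcon t ht).2.le.trans (measure_mono fun y hy => ⟨fun i => ?_, fun h => hy.2 ?_⟩)
      · induction i using Fin.lastCases with
        | last =>
          rw [Fin.insertNth_last', Fin.snoc_last]
          exact C.subset (by omega) htC
        | cast i =>
          rw [Fin.insertNth_last', Fin.snoc_castSucc]
          exact C.subset (by omega) (hy.1 i)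
      · exact hV.antitone (by omega) h
    · obtain ⟨t, ht⟩ := hae.exists
      exact ⟨t, ht, fun h => (hsm h).elim⟩
  refine ⟨AEEqFun.mk _ (hφm.comp_measurable (hins t)).aestronglyMeasurable, ?_, fun h => ?_⟩
  · refine AEEqFun.ext ((coeFn_d μ A _).trans ((dFun_congr μ A (AEEqFun.coeFn_mk _ _)).trans ?_))
    filter_upwards [ht1] with y hy
    rw [dFun_insertNth_last, sub_eq_zero] at hy
    exact hy.symm
  · refine mem_smallSet_of_ae_imp (ht2 h) ?_
    filter_upwards [AEEqFun.coeFn_mk _ (hφm.comp_measurable (hins t)).aestronglyMeasurable]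
      with y h1 h2 h3
    rw [h1]
    exact not_not.1 fun h4 => h3 ⟨h2, h4⟩

end SmallSet
end MooreCohomology

/-! ### Continuity of the diagonal action and joint measurability -/

namespace MooreCohomology

open scoped ENNReal

set_option linter.unusedSectionVars false

variable {G : Type*} [Group G] [TopologicalSpace G] [IsTopologicalGroup G]
  [LocallyCompactSpace G] [SecondCountableTopology G] [T2Space G]
  [MeasurableSpace G] [BorelSpace G] {μ : Measure G} [μ.IsHaarMeasure]
  {A : Type*} [AddCommGroup A] [TopologicalSpace A] [IsTopologicalAddGroup A]

instance innerRegularCompactLTTop_powMeasure (m : ℕ) :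
    (powMeasure μ m).InnerRegularCompactLTTop := by
  let := TopologicalSpace.metrizableSpaceMetric (Fin m → G)
  infer_instance

theorem isCompact_pi_exhaustion (C : CompactExhaustion G) (m n : ℕ) :
    IsCompact {y : Fin m → G | ∀ i, y i ∈ C n} :=
  isCompact_pi_infinite fun _ => C.isCompact n

section Zero

theorem ae_powMeasure_zero {P : (Fin 0 → G) → Prop} (h : ∀ᵐ y ∂powMeasure μ 0, P y)
    (y : Fin 0 → G) : P y := by
  obtain ⟨y', hy'⟩ := h.exists
  rwa [Subsingleton.elim y y']

theorem powMeasure_zero_univ : powMeasure μ 0 Set.univ = 1 := by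
  simp [powMeasure]

/-- `G^0` is one point of mass `1`, so an exceptional set of measure at most `2^-(n+1) < 1` is
empty. At index `0` the bound would say nothing. -/
theorem apply_mem_of_mem_smallSet {C : CompactExhaustion G} {V : ℕ → Set A} {n : ℕ}
    {φ : Cochain μ A 0} (h : φ ∈ smallSet μ C V 0 (n + 1)) (y : Fin 0 → G) : φ y ∈ V (n + 1) := by
  by_contra hy
  have : {y : Fin 0 → G | (∀ i, y i ∈ C (n + 1)) ∧ φ y ∉ V (n + 1)} = Set.univ := by
    ext y'
    rw [Subsingleton.elim y' y]
    simp [hy]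
  unfold smallSet at h
  rw [Set.mem_ofPred_eq, this, powMeasure_zero_univ] at h
  exact absurd h (not_le.2 (pow_lt_one₀ zero_le (by simp) (by omega)))

theorem eq_zero_of_d_eq_zero {φ : Cochain μ A 0} (h : d μ A 0 φ = 0) : φ = 0 := by
  refine AEEqFun.ext (Eventually.of_forall fun y => ?_)
  obtain ⟨x, h1, h2⟩ := ((coeFn_d μ A φ).and (h ▸ AEEqFun.coeFn_zero)).exists
  have h3 := ae_powMeasure_zero (AEEqFun.coeFn_zero (μ := powMeasure μ 0) (β := A)) y
  have h4 : dFun φ x = φ y := by simp [dFun, Subsingleton.elim _ y]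
  rw [h3, ← h4, ← h1, h2]
  rfl

end Zero

section Action

variable [DistribMulAction G A] [ContinuousSMul G A]

theorem diagAct_one {m : ℕ} (φ : Cochain μ A m) : diagAct μ (1 : G) φ = φ :=
  AEEqFun.ext ((coeFn_diagAct μ A 1 φ).trans (Eventually.of_forall fun x => by simp))

theorem diagAct_mul {m : ℕ} (g h : G) (φ : Cochain μ A m) :
    diagAct μ (g * h) φ = diagAct μ g (diagAct μ h φ) := by
  refine AEEqFun.ext ((coeFn_diagAct μ A _ φ).trans (EventuallyEq.symm ?_))
  filter_upwards [coeFn_diagAct μ A g (diagAct μ h φ),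
    (measurePreserving_translate μ m g⁻¹).quasiMeasurePreserving.ae (coeFn_diagAct μ A h φ)]
    with x h1 h2
  rw [h1, h2, mul_smul]
  simp only [mul_inv_rev, mul_assoc]

theorem IsNhdsChain.exists_smul_mem {V : ℕ → Set A} (hV : IsNhdsChain V) {K : Set G}
    (hK : IsCompact K) (n : ℕ) : ∃ j, ∀ g ∈ K, ∀ a ∈ V j, g • a ∈ V n := by
  have h : ∀ᶠ a in 𝓝 (0 : A), ∀ g ∈ K, g • a ∈ V n := by
    refine hK.eventually_forall_of_forall_eventually fun g _ => ?_
    have hc : Continuous fun z : A × G => z.2 • z.1 := continuous_snd.smul continuous_fst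
    refine hc.continuousAt.eventually (p := (· ∈ V n)) ?_
    dsimp only
    rw [smul_zero]
    exact hV.mem_nhds n
  obtain ⟨j, hj⟩ := hV.exists_subset _ h
  exact ⟨j, fun g hg a ha => hj ha g hg⟩

variable [PolishSpace A] {C : CompactExhaustion G} {V : ℕ → Set A}

theorem measurableSet_exceptional (hV : IsNhdsChain V) {m : ℕ} (φ : Cochain μ A m) (n : ℕ) :
    MeasurableSet {y | (∀ i, y i ∈ C n) ∧ φ y ∉ V n} := by
  borelize A
  exact (isCompact_pi_exhaustion C m n).measurableSet.inter
    (φ.stronglyMeasurable.measurable (hV.isOpen _).measurableSet).compl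

-- Translation preserves the measure and moves `C n` into the compact set `K⁻¹ * C n`, which some `C
-- j` contains.
open scoped Pointwise in
theorem exists_diagAct_mem_smallSet (hV : IsNhdsChain V) (m : ℕ) {K : Set G} (hK : IsCompact K)
    (n : ℕ) : ∃ j, ∀ g ∈ K, ∀ φ ∈ smallSet μ C V m j, diagAct μ g φ ∈ smallSet μ C V m n := by
  obtain ⟨j₁, hj₁⟩ := hV.exists_smul_mem hK n
  obtain ⟨j₂, hj₂⟩ := C.exists_superset_of_isCompact (hK.inv.mul (C.isCompact n))
  let j := n + j₁ + j₂
  refine ⟨j, fun g hg φ hφ => ?_⟩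
  refine mem_smallSet_of_ae_imp (E := (fun (x : Fin m → G) i => g⁻¹ * x i) ⁻¹'
    {y | (∀ i, y i ∈ C j) ∧ φ y ∉ V j}) ?_ ?_
  · rw [(measurePreserving_translate μ m g⁻¹).measure_preimage
      (measurableSet_exceptional hV φ j).nullMeasurableSet]
    exact le_trans hφ (pow_le_pow_right_of_le_one' (by simp) (by omega))
  · filter_upwards [coeFn_diagAct μ A g φ] with x h1 h2 h3
    rw [h1]
    refine hj₁ g hg _ (hV.antitone (by omega : j₁ ≤ j) (not_not.1 fun h4 => h3 ⟨fun i => ?_, h4⟩))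
    exact C.subset (by omega) (hj₂ (Set.mul_mem_mul (Set.inv_mem_inv.2 hg) (h2 i)))

theorem tendsto_measure_translate_symmDiff {m : ℕ} {E : Set (Fin m → G)} (hE : MeasurableSet E)
    (hE' : powMeasure μ m E ≠ ∞) : Tendsto (fun g : G => powMeasure μ m
      (symmDiff ((fun (x : Fin m → G) i => g⁻¹ * x i) ⁻¹' E) E)) (𝓝 1) (𝓝 0) := by
  let F : C(G × (Fin m → G), Fin m → G) := ⟨fun z i => z.1⁻¹ * z.2 i, by fun_prop⟩
  have h := tendsto_measure_symmDiff_preimage_nhds_zero (μ := powMeasure μ m)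
    (ν := powMeasure μ m) (f := F.curry) (g := F.curry 1) (F.curry.continuous.tendsto 1)
    (Eventually.of_forall fun g => measurePreserving_translate μ m g⁻¹)
    (measurePreserving_translate μ m 1⁻¹) hE.nullMeasurableSet hE'
  have h1 : (F.curry 1) ⁻¹' E = E := by
    ext x
    simp [F]
  rwa [h1] at h

/-- Up to small measure, the cube is covered by finitely many sets `E i` on which `φ` is close to a
constant `b i`. For `g` near `1`, translation barely moves `E i` and `g • b i` is close to `b i`.
Hence `g • φ (g⁻¹ y)`, `g • b i`, `b i` and `φ y` are successively close off a small set. -/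
theorem eventually_diagAct_sub_mem_one (hV : IsNhdsChain V) {m : ℕ} (φ : Cochain μ A m) (n : ℕ) :
    ∀ᶠ g in 𝓝 (1 : G), diagAct μ g φ - φ ∈ smallSet μ C V m n := by
  borelize A
  obtain ⟨K, hK, hK1⟩ := exists_compact_mem_nhds (1 : G)
  obtain ⟨j, hj⟩ := hV.exists_smul_mem hK (n + 1)
  let l := j + n + 2
  let b : ℕ → A := TopologicalSpace.denseSeq A
  let D : Set (Fin m → G) := {y | ∀ i, y i ∈ C n}
  have hD : IsCompact D := isCompact_pi_exhaustion C m n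
  let E : ℕ → Set (Fin m → G) := fun i => D ∩ {y | φ y - b i ∈ V l}
  have hE : ∀ i, MeasurableSet (E i) := fun i => hD.measurableSet.inter
    ((φ.stronglyMeasurable.measurable.sub_const (b i)) (hV.isOpen l).measurableSet)
  have hDE : ⋂ M, D \ ⋃ i ∈ Finset.range M, E i = ∅ := by
    refine Set.eq_empty_iff_forall_notMem.2 fun y hy => ?_
    rw [Set.mem_iInter] at hy
    have ho : IsOpen {a | φ y - a ∈ V l} := (hV.isOpen l).preimage (continuous_const.sub continuous_id)
    obtain ⟨i, hi⟩ := (TopologicalSpace.denseRange_denseSeq A).exists_mem_open ho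
      ⟨φ y, by simpa using hV.zero_mem l⟩
    exact (hy (i + 1)).2 (Set.mem_biUnion (x := i) (by simp) ⟨(hy 0).1, hi⟩)
  have hlim : Tendsto (fun M => powMeasure μ m (D \ ⋃ i ∈ Finset.range M, E i)) atTop (𝓝 0) := by
    rw [← measure_empty (μ := powMeasure μ m), ← hDE]
    refine tendsto_measure_iInter_atTop (fun M => (hD.measurableSet.diff
      (.biUnion (Finset.countable_toSet _) fun i _ => hE i)).nullMeasurableSet) ?_
      ⟨0, ((measure_mono Set.sdiff_subset).trans_lt hD.measure_lt_top).ne⟩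
    exact fun M N hMN => Set.sdiff_subset_sdiff_right
      (Set.biUnion_subset_biUnion_left fun i hi => by
        simp only [Finset.mem_range, Finset.mem_coe] at hi ⊢; omega)
  obtain ⟨M, hM⟩ := ((ENNReal.tendsto_nhds_zero.1 hlim) (2⁻¹ ^ (n + 1))
    (ENNReal.pow_pos (by simp) _)).exists
  have hsymm : ∀ᶠ g in 𝓝 (1 : G), ∑ i ∈ Finset.range M, powMeasure μ m
      (symmDiff ((fun (x : Fin m → G) i => g⁻¹ * x i) ⁻¹' E i) (E i)) ≤ 2⁻¹ ^ (n + 1) := by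
    have := tendsto_finsetSum (Finset.range M) fun i _ =>
      tendsto_measure_translate_symmDiff (μ := μ) (hE i)
        ((measure_mono Set.inter_subset_left).trans_lt hD.measure_lt_top).ne
    rw [Finset.sum_const_zero] at this
    exact ENNReal.tendsto_nhds_zero.1 this _ (ENNReal.pow_pos (by simp) _)
  have hval : ∀ᶠ g in 𝓝 (1 : G), ∀ i ∈ Finset.range M, g • b i - b i ∈ V l := by
    refine (Finset.eventually_all _).2 fun i _ => ?_
    refine hV.tendsto_iff.1 ?_ l
    have hc : Continuous fun g : G => g • b i := continuous_id.smul continuous_const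
    simpa using hc.tendsto 1
  filter_upwards [hsymm, hval, hK1] with g h1 h2 hgK
  refine mem_smallSet_of_ae_imp (E := (D \ ⋃ i ∈ Finset.range M, E i) ∪ ⋃ i ∈ Finset.range M,
    symmDiff ((fun (x : Fin m → G) i => g⁻¹ * x i) ⁻¹' E i) (E i)) ?_ ?_
  · refine (measure_union_le _ _).trans ((add_le_add hM
      ((measure_biUnion_finset_le _ _).trans h1)).trans_eq ?_)
    rw [← two_mul, pow_succ', ← mul_assoc, ENNReal.mul_inv_cancel two_ne_zero
      ENNReal.ofNat_ne_top, one_mul]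
  · filter_upwards [AEEqFun.coeFn_sub (diagAct μ g φ) φ, coeFn_diagAct μ A g φ]
      with y h3 h4 h5 h6
    rw [h3, Pi.sub_apply, h4]
    rw [Set.mem_union, not_or] at h6
    obtain ⟨i, hi, hiE⟩ : ∃ i ∈ Finset.range M, y ∈ E i := by
      by_contra! hcon
      exact h6.1 ⟨h5, by simpa using hcon⟩
    have hgE : (fun i => g⁻¹ * y i) ∈ E i := by
      by_contra hcon
      exact h6.2 (Set.mem_biUnion (x := i) hi (.inr ⟨hiE, hcon⟩))
    have e1 := hj g hgK _ (hV.antitone (by omega : j ≤ l) hgE.2)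
    have e2 := hV.sub_mem (hV.antitone (by omega : n + 1 + 1 ≤ l) (h2 i hi))
      (hV.antitone (by omega : n + 1 + 1 ≤ l) hiE.2)
    convert hV.add_mem n _ e1 _ e2 using 1
    rw [smul_sub]
    abel

theorem eventually_diagAct_sub_mem (hV : IsNhdsChain V) {m : ℕ} (φ : Cochain μ A m) (n : ℕ)
    (g₀ : G) : ∀ᶠ g in 𝓝 g₀, diagAct μ g φ - diagAct μ g₀ φ ∈ smallSet μ C V m n := by
  obtain ⟨j, hj⟩ := exists_diagAct_mem_smallSet (μ := μ) (C := C) hV m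
    (isCompact_singleton (x := g₀)) n
  have h : Tendsto (fun g => g₀⁻¹ * g) (𝓝 g₀) (𝓝 1) := by
    simpa using (continuous_const_mul g₀⁻¹).tendsto g₀
  filter_upwards [h.eventually (eventually_diagAct_sub_mem_one (C := C) hV φ j)] with g hg
  simpa [← diagAct_mul] using hj g₀ rfl _ hg

end Action

section Joint

/-- A locally uniform limit of type-I functions with values in classes of functions is
represented by a jointly measurable function. -/
theorem NiceAt.exists_joint [PolishSpace A] {C : CompactExhaustion G} {V : ℕ → Set A}
    (hV : IsNhdsChain V) {X : Type*} [TopologicalSpace X] [MeasurableSpace X] [SigmaCompactSpace X]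
    [WeaklyLocallyCompactSpace X] {ν : Measure X} {x₀ : X} {m : ℕ} {u : X → Cochain μ A m}
    (hu : NiceAt (smallSet μ C V m) ν x₀ u) :
    ∃ U : X × (Fin m → G) → A, StronglyMeasurable U ∧
      ∀ x, ∀ᵐ y ∂powMeasure μ m, U (x, y) = u x y := by
  borelize A
  let D : CompactExhaustion X := default
  obtain ⟨γ, h1, h2⟩ := hu.exists_rapid D id
  have hm : ∀ n, StronglyMeasurable fun z : X × (Fin m → G) => γ n z.1 z.2 := by
    intro n
    refine Measurable.stronglyMeasurable fun s hs => ?_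
    have : (fun z : X × (Fin m → G) => γ n z.1 z.2) ⁻¹' s =
        ⋃ a ∈ Set.range (γ n), (γ n ⁻¹' {a}) ×ˢ (a ⁻¹' s) := by
      ext z
      simp only [Set.mem_preimage, Set.mem_iUnion, Set.mem_prod, Set.mem_singleton_iff]
      exact ⟨fun hz => ⟨γ n z.1, ⟨_, rfl⟩, rfl, hz⟩, fun ⟨a, _, ha, hz⟩ => ha ▸ hz⟩
    rw [this]
    exact .biUnion (h1 n).countable_range fun a _ =>
      ((h1 n).measurableSet_preimage _).prod (a.stronglyMeasurable.measurable hs)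
  refine ⟨fun z => limUnder atTop fun n => γ n z.1 z.2, StronglyMeasurable.limUnder hm,
    fun x => ?_⟩
  obtain ⟨N, hN⟩ := D.exists_mem x
  filter_upwards [tendsto_ae_of_mem_smallSet hV fun n hn => h2 n x (D.subset hn hN)] with y hy
  exact hy.limUnder_eq

end Joint

end MooreCohomology

/-! ### Homogeneous coordinates and the dimension shift -/

namespace MooreCohomology

open scoped ENNReal

set_option linter.unusedSectionVars false

section Shear

variable {G : Type*} [Group G] [TopologicalSpace G] [IsTopologicalGroup G]
  [LocallyCompactSpace G] [SecondCountableTopology G] [T2Space G]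
  [MeasurableSpace G] [BorelSpace G] (μ : Measure G) [μ.IsHaarMeasure]

theorem quasiMeasurePreserving_inv_mul_succ (k : ℕ) :
    Measure.QuasiMeasurePreserving (fun (x : Fin (k + 1) → G) (i : Fin k) => (x 0)⁻¹ * x i.succ)
      (powMeasure μ (k + 1)) (powMeasure μ k) := by
  have h : Measure.QuasiMeasurePreserving
      (fun z : G × (Fin k → G) => fun i => z.1⁻¹ * z.2 i) (μ.prod (powMeasure μ k))
      (powMeasure μ k) :=
    QuasiMeasurePreserving.prod_of_right (by fun_prop) (Eventually.of_forall fun t =>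
      (measurePreserving_translate μ k t⁻¹).quasiMeasurePreserving)
  exact h.comp (measurePreserving_piFinSuccAbove (fun _ => μ) 0).quasiMeasurePreserving

end Shear

section Homog

variable {G : Type*} [Group G] [TopologicalSpace G] [IsTopologicalGroup G]
  [LocallyCompactSpace G] [SecondCountableTopology G] [T2Space G]
  [MeasurableSpace G] [BorelSpace G] {μ : Measure G} [μ.IsHaarMeasure]
  {A : Type*} [AddCommGroup A] [TopologicalSpace A] [IsTopologicalAddGroup A]
  [DistribMulAction G A] [ContinuousSMul G A] {k m : ℕ}

/-- The homogeneous form of a cochain in inhomogeneous coordinates. -/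
noncomputable def homog (u : (Fin k → G) → Cochain μ A m) (x : Fin (k + 1) → G) : Cochain μ A m :=
  diagAct μ (x 0) (u fun i => (x 0)⁻¹ * x i.succ)

theorem homog_translate (u : (Fin k → G) → Cochain μ A m) (g : G) (x : Fin (k + 1) → G) :
    homog u (fun i => g * x i) = diagAct μ g (homog u x) := by
  simp only [homog, diagAct_mul, mul_inv_rev, mul_assoc, inv_mul_cancel_left]

theorem homog_cons_one (u : (Fin k → G) → Cochain μ A m) (z : Fin k → G) :
    homog u (Fin.cons (α := fun _ => G) 1 z) = u z := by
  simp [homog, diagAct_one]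

theorem dFun_translate {n : ℕ} {b : (Fin n → G) → Cochain μ A m}
    (hb : ∀ g x, b (fun i => g * x i) = diagAct μ g (b x)) (g : G) (x : Fin (n + 1) → G) :
    dFun b (fun i => g * x i) = diagAct μ g (dFun b x) := by
  simp only [dFun, map_sum, map_zsmul]
  exact Finset.sum_congr rfl fun i _ => congrArg _ (hb g (i.removeNth x))

theorem eq_homog {b : (Fin (k + 1) → G) → Cochain μ A m}
    (hb : ∀ g x, b (fun i => g * x i) = diagAct μ g (b x)) (x : Fin (k + 1) → G) :
    b x = homog (fun z => b (Fin.cons (α := fun _ => G) 1 z)) x := by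
  rw [homog, ← hb]
  congr 1
  ext i
  refine Fin.cases ?_ (fun j => ?_) i
  · simp
  · simp

theorem d_dFun_comm {n : ℕ} (b : (Fin n → G) → Cochain μ A m) (x : Fin (n + 1) → G) :
    d μ A m (dFun b x) = dFun (fun x => d μ A m (b x)) x := by
  simp only [dFun, map_sum, map_zsmul]

theorem d_homog (u : (Fin k → G) → Cochain μ A m) (x : Fin (k + 1) → G) :
    d μ A m (homog u x) = homog (fun z => d μ A m (u z)) x :=
  (diagAct_d μ A _ _).symm

variable [PolishSpace A] {C : CompactExhaustion G} {V : ℕ → Set A}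

theorem NiceAt.homog (hV : IsNhdsChain V) {u : (Fin k → G) → Cochain μ A m}
    (hu : NiceAt (smallSet μ C V m) (powMeasure μ k) 1 u) :
    NiceAt (smallSet μ C V m) (powMeasure μ (k + 1)) 1 (homog u) := by
  have hu' : NiceAt (smallSet μ C V m) (powMeasure μ k)
      (fun i : Fin k => ((1 : Fin (k + 1) → G) 0)⁻¹ * (1 : Fin (k + 1) → G) i.succ) u := by
    have h1 : (fun i : Fin k => ((1 : Fin (k + 1) → G) 0)⁻¹ * (1 : Fin (k + 1) → G) i.succ) = 1 := by
      ext i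
      simp
    rwa [h1]
  have hπ : Continuous fun (x : Fin (k + 1) → G) (i : Fin k) => (x 0)⁻¹ * x i.succ :=
    continuous_pi fun i => (continuous_apply 0).inv.mul (continuous_apply i.succ)
  have hθ : Measure.QuasiMeasurePreserving (fun x : Fin (k + 1) → G => x 0) (powMeasure μ (k + 1))
      μ := Measure.quasiMeasurePreserving_eval _ 0
  have hθ' : Continuous fun x : Fin (k + 1) → G => x 0 := continuous_apply 0
  have hW := isAddChain_smallSet (μ := μ) (C := C) (m := m) hV.toIsAddChain
  have h1 := fun (K : Set G) (hK : IsCompact K) n =>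
    exists_diagAct_mem_smallSet (μ := μ) (C := C) hV m hK n
  have h2 := fun (a : Cochain μ A m) n g₀ => eventually_diagAct_sub_mem (C := C) hV a n g₀
  exact NiceAt.twist hW (fun g => diagAct μ g) h1 h2 hu' hπ
    (quasiMeasurePreserving_inv_mul_succ μ k) hθ' hθ

/-- With first coordinate `1`, the face omitting it is `homog u` itself, and the other faces are `u`
after a coordinate projection. Only the first face involves the action. -/
theorem NiceAt.dFun_homog_cons (hV : IsNhdsChain V) {u : (Fin k → G) → Cochain μ A m}
    (hu : NiceAt (smallSet μ C V m) (powMeasure μ k) 1 u) :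
    NiceAt (smallSet μ C V m) (powMeasure μ (k + 1)) 1
      fun z => dFun (MooreCohomology.homog u) (Fin.cons (α := fun _ => G) 1 z) := by
  have hW := isAddChain_smallSet (μ := μ) (C := C) (m := m) hV.toIsAddChain
  refine NiceAt.sum hW _ fun i => NiceAt.neg_one_pow_smul hW ?_ _
  refine Fin.cases ?_ (fun j => ?_) i
  · convert hu.homog hV using 2 with z
    congr 1
  · have h := NiceAt.comp_continuous (x₀ := (1 : Fin (k + 1) → G))
      (π := fun x : Fin (k + 1) → G => j.removeNth x) (f := u) (ν' := powMeasure μ k)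
      hu (continuous_pi fun i => continuous_apply _)
      (quasiMeasurePreserving_removeNth μ j)
    convert h using 2 with z
    rw [← homog_cons_one u]
    congr 1
    ext i
    refine Fin.cases ?_ (fun l => ?_) i
    · simp [Fin.removeNth]
    · simp [Fin.removeNth]

/-- One step of dimension shifting: the outer differential of a cochain with values in cocycles is
lifted through the inner differential. -/
theorem NiceAt.exists_shift (hV : IsNhdsChain V) {u : (Fin k → G) → Cochain μ A (m + 1)}
    (hu : NiceAt (smallSet μ C V (m + 1)) (powMeasure μ k) 1 u)
    (hd : ∀ x, d μ A (m + 1) (dFun (MooreCohomology.homog u) x) = 0) (l : ℕ) :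
    ∃ v : (Fin (k + 1) → G) → Cochain μ A m,
      NiceAt (smallSet μ C V m) (powMeasure μ (k + 1)) 1 v ∧
      (∀ x, d μ A m (MooreCohomology.homog v x) =
        (-1 : ℤ) ^ l • dFun (MooreCohomology.homog u) x) ∧
      ∀ x, d μ A m (dFun (MooreCohomology.homog v) x) = 0 := by
  have hW := isAddChain_smallSet (μ := μ) (C := C) (m := m) hV.toIsAddChain
  have hW' := isAddChain_smallSet (μ := μ) (C := C) (m := m + 1) hV.toIsAddChain
  -- The lift is taken on tuples with first coordinate `1` only, where no equivariance is required;
  -- `homog` then extends it equivariantly, and `d` commutes with the action.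
  obtain ⟨v, hv, hdv⟩ := NiceAt.exists_lift hW hW' (d μ A m) (d μ A (m + 1)).ker
    (fun b hb => by
      obtain ⟨j, hj⟩ := exists_d_eq (μ := μ) (C := C) (m := m) hV 0
      obtain ⟨a, ha, -⟩ := hj b hb
      exact ⟨a, ha⟩)
    (fun n => by
      obtain ⟨j, hj⟩ := exists_d_eq (μ := μ) (C := C) (m := m) hV n
      refine ⟨j, fun b hb hbj => ?_⟩
      obtain ⟨a, ha, ha'⟩ := hj b hb
      exact ⟨a, ha' hbj, ha⟩)
    (exists_sum_smallSet hV) (d_eq_of_mem_smallSet hV)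
    ((hu.dFun_homog_cons hV).neg_one_pow_smul hW' l)
    (fun z => by
      rw [AddMonoidHom.mem_ker, map_zsmul, hd, smul_zero])
  have h1 : ∀ x, d μ A m (MooreCohomology.homog v x) =
      (-1 : ℤ) ^ l • dFun (MooreCohomology.homog u) x := by
    intro x
    rw [d_homog, eq_homog (dFun_translate (homog_translate u)) x]
    simp only [hdv, MooreCohomology.homog, map_zsmul]
  refine ⟨v, hv, h1, fun x => ?_⟩
  rw [d_dFun_comm]
  simp only [h1]
  have h2 := dFun_dFun (MooreCohomology.homog u) x
  simp only [dFun] at h2 ⊢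
  simp only [smul_comm _ ((-1 : ℤ) ^ l), ← Finset.smul_sum] at h2 ⊢
  rw [h2, smul_zero]

end Homog
end MooreCohomology

/-! ### The double complex of functions -/

namespace MooreCohomology

open scoped ENNReal

set_option linter.unusedSectionVars false

section Bidegree

variable {G : Type*} {A : Type*} [AddCommGroup A] {k m : ℕ}

/-- The differential in the first group of variables. -/
def dLeft (F : (Fin k → G) × (Fin m → G) → A) : (Fin (k + 1) → G) × (Fin m → G) → A :=
  fun z => dFun (fun x => F (x, z.2)) z.1

/-- The differential in the second group of variables. -/
def dRight (F : (Fin k → G) × (Fin m → G) → A) : (Fin k → G) × (Fin (m + 1) → G) → A :=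
  fun z => dFun (fun y => F (z.1, y)) z.2

theorem dFun_zsmul {n : ℕ} (c : ℤ) (f : (Fin n → G) → A) (x : Fin (n + 1) → G) :
    dFun (c • f) x = c • dFun f x := by
  simp only [dFun, Pi.smul_apply, Finset.smul_sum, smul_comm c]

theorem dFun_sub {n : ℕ} (f g : (Fin n → G) → A) (x : Fin (n + 1) → G) :
    dFun (f - g) x = dFun f x - dFun g x := by
  simp only [dFun, Pi.sub_apply, smul_sub, Finset.sum_sub_distrib]

theorem dLeft_sub (F H : (Fin k → G) × (Fin m → G) → A) : dLeft (F - H) = dLeft F - dLeft H :=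
  funext fun z => dFun_sub (fun x => F (x, z.2)) (fun x => H (x, z.2)) z.1

theorem dRight_sub (F H : (Fin k → G) × (Fin m → G) → A) : dRight (F - H) = dRight F - dRight H :=
  funext fun z => dFun_sub (fun y => F (z.1, y)) (fun y => H (z.1, y)) z.2

theorem dLeft_zsmul (c : ℤ) (F : (Fin k → G) × (Fin m → G) → A) : dLeft (c • F) = c • dLeft F :=
  funext fun z => dFun_zsmul c (fun x => F (x, z.2)) z.1

theorem dRight_zsmul (c : ℤ) (F : (Fin k → G) × (Fin m → G) → A) :
    dRight (c • F) = c • dRight F :=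
  funext fun z => dFun_zsmul c (fun y => F (z.1, y)) z.2

theorem dLeft_dLeft (F : (Fin k → G) × (Fin m → G) → A) : dLeft (dLeft F) = 0 :=
  funext fun z => dFun_dFun (fun x => F (x, z.2)) z.1

theorem dRight_dLeft (F : (Fin k → G) × (Fin m → G) → A) :
    dRight (dLeft F) = dLeft (dRight F) := by
  funext z
  simp only [dRight, dLeft, dFun, Finset.smul_sum]
  rw [Finset.sum_comm]
  exact Finset.sum_congr rfl fun i _ => Finset.sum_congr rfl fun j _ => smul_comm _ _ _

/-- Equivariance at every point under the diagonal action. -/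
def IsEquivariant [Group G] [DistribMulAction G A] (F : (Fin k → G) × (Fin m → G) → A) : Prop :=
  ∀ g x y, F (fun i => g * x i, fun i => g * y i) = g • F (x, y)

variable [Group G] [DistribMulAction G A] {F H : (Fin k → G) × (Fin m → G) → A}

theorem IsEquivariant.sub (hF : IsEquivariant F) (hH : IsEquivariant H) : IsEquivariant (F - H) :=
  fun g x y => by simp only [Pi.sub_apply, hF g x y, hH g x y, smul_sub]

theorem IsEquivariant.zsmul (hF : IsEquivariant F) (c : ℤ) : IsEquivariant (c • F) :=
  fun g x y => by simp only [Pi.smul_apply, hF g x y, smul_comm g c]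

theorem IsEquivariant.dLeft (hF : IsEquivariant F) : IsEquivariant (dLeft F) := fun g x y => by
  simp only [MooreCohomology.dLeft, dFun, Finset.smul_sum]
  refine Finset.sum_congr rfl fun i _ => ?_
  rw [smul_comm g]
  exact congrArg _ (hF g (i.removeNth x) y)

end Bidegree

section Concat

variable {G : Type*}

/-- Extension of a tuple by ones. -/
def padOne [One G] {k : ℕ} (x : Fin k → G) (l : ℕ) : G :=
  if h : l < k then x ⟨l, h⟩ else 1

/-- Concatenation of tuples, padded with ones to the length `n`. -/
def concat [One G] {k m : ℕ} (n : ℕ) (x : Fin k → G) (y : Fin m → G) : Fin n → G := fun i =>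
  if (i : ℕ) < k then padOne x i else padOne y (i - k)

theorem padOne_val [One G] {k : ℕ} (x : Fin k → G) (i : Fin k) : padOne x i = x i :=
  dif_pos i.2

theorem padOne_of_ge [One G] {k l : ℕ} (x : Fin k → G) (h : k ≤ l) : padOne x l = 1 :=
  dif_neg h.not_gt

theorem val_succAbove {n : ℕ} (i : Fin (n + 1)) (j : Fin n) :
    (i.succAbove j : ℕ) = if (j : ℕ) < i then (j : ℕ) else j + 1 := by
  simp only [Fin.succAbove, Fin.lt_def, Fin.val_castSucc]
  split_ifs <;> rfl

theorem padOne_removeNth [One G] {k : ℕ} (x : Fin (k + 1) → G) (i : Fin (k + 1)) (l : ℕ) :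
    padOne (i.removeNth x) l = if l < i then padOne x l else padOne x (l + 1) := by
  have hi := i.2
  by_cases h : l < k
  · have h1 := padOne_val (i.removeNth x) ⟨l, h⟩
    have h2 := padOne_val x (i.succAbove ⟨l, h⟩)
    rw [val_succAbove] at h2
    dsimp only at h1 h2
    rw [h1, Fin.removeNth_apply, ← h2]
    split_ifs <;> rfl
  · rw [padOne_of_ge _ (by omega), if_neg (by omega), padOne_of_ge _ (by omega)]

theorem concat_eq_append [One G] {k m : ℕ} (x : Fin k → G) (y : Fin m → G) :
    concat (k + m) x y = Fin.append x y := by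
  ext i
  refine Fin.addCases (fun i => ?_) (fun i => ?_) i
  · simp [concat, padOne_val]
  · simp [concat, padOne_val]

theorem concat_translate [Group G] {k m n : ℕ} (h : n = k + m) (g : G) (x : Fin k → G)
    (y : Fin m → G) :
    concat n (fun i => g * x i) (fun i => g * y i) = fun i => g * concat n x y i := by
  subst h
  simp only [concat_eq_append]
  ext i
  refine Fin.addCases (fun i => ?_) (fun i => ?_) i
  · simp
  · simp

theorem concat_zero [One G] {n : ℕ} (x : Fin n → G) (y : Fin 0 → G) : concat n x y = x := by
  ext i
  simp [concat, padOne_val]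

theorem zero_concat [One G] {n : ℕ} (x : Fin 0 → G) (y : Fin n → G) : concat n x y = y := by
  ext i
  simp [concat, padOne_val]

/-- Padding makes the length `n` independent of `k` and `m`, so that faces of either block are
compared without casts. -/
theorem removeNth_concat_left [One G] {k m n : ℕ} (x : Fin (k + 1) → G) (y : Fin m → G)
    (i : Fin (n + 1)) (i' : Fin (k + 1)) (hi : (i : ℕ) = i') :
    i.removeNth (concat (n + 1) x y) = concat n (i'.removeNth x) y := by
  ext j
  have hi' := i'.2
  simp only [concat, Fin.removeNth_apply, val_succAbove, padOne_removeNth]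
  rcases lt_or_ge (j : ℕ) i with h | h
  · rw [if_pos h, if_pos (by omega), if_pos (by omega), if_pos (by omega)]
  · rw [if_neg h.not_gt]
    by_cases h' : (j : ℕ) < k
    · rw [if_pos (by omega), if_pos (by omega), if_neg (by omega)]
    · rw [if_neg (by omega), if_neg (by omega), Nat.add_sub_add_right]

theorem removeNth_concat_right [One G] {k m n : ℕ} (x : Fin k → G) (y : Fin (m + 1) → G)
    (i : Fin (n + 1)) (j : Fin (m + 1)) (hi : (i : ℕ) = k + j) :
    i.removeNth (concat (n + 1) x y) = concat n x (j.removeNth y) := by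
  ext l
  simp only [concat, Fin.removeNth_apply, val_succAbove, padOne_removeNth]
  rcases lt_or_ge (l : ℕ) i with h | h
  · rw [if_pos h]
    by_cases h' : (l : ℕ) < k
    · rw [if_pos (by omega), if_pos (by omega)]
    · rw [if_neg (by omega), if_neg (by omega), if_pos (by omega)]
  · rw [if_neg h.not_gt, if_neg (by omega), if_neg (by omega), if_neg (by omega),
      Nat.sub_add_comm (by omega)]

/-- Signs are counted from the last variable, so each face of the first block gains `(-1)^(m+1)`
from the `m + 1` variables after it. -/
theorem dFun_concat [One G] {A : Type*} [AddCommGroup A] {k m n : ℕ} (h : n = k + 1 + m)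
    (f : (Fin n → G) → A) (x : Fin (k + 1) → G) (y : Fin (m + 1) → G) :
    dFun f (concat (n + 1) x y) =
      (-1 : ℤ) ^ (m + 1) • dLeft (fun z => f (concat n z.1 z.2)) (x, y) +
        dRight (fun z => f (concat n z.1 z.2)) (x, y) := by
  subst h
  simp only [dFun, dLeft, dRight, Finset.smul_sum]
  refine (Fin.sum_univ_add (a := k + 1) (b := m + 1) _).trans ?_
  congr 1
  · refine Finset.sum_congr rfl fun i _ => ?_
    rw [smul_smul, ← pow_add]
    congr 1
    · congr 1
      have := i.2
      simp only [Fin.val_castAdd]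
      omega
    · exact congrArg f (removeNth_concat_left x y _ i rfl)
  · refine Finset.sum_congr rfl fun j _ => ?_
    congr 1
    · congr 1
      simp only [Fin.val_natAdd]
      omega
    · exact congrArg f (removeNth_concat_right x y _ j rfl)

theorem measurePreserving_concat [One G] [MeasurableSpace G] (μ : Measure G) [SigmaFinite μ]
    {k m n : ℕ} (h : n = k + m) : MeasurePreserving
      (fun z : (Fin k → G) × (Fin m → G) => concat n z.1 z.2)
      ((powMeasure μ k).prod (powMeasure μ m)) (powMeasure μ n) := by
  subst h
  have hm : Measurable fun z : (Fin k → G) × (Fin m → G) => concat (k + m) z.1 z.2 := by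
    refine measurable_pi_lambda _ fun i => ?_
    simp only [concat, padOne]
    split_ifs <;> fun_prop
  refine ⟨hm, (Measure.pi_eq fun s hs => ?_).symm⟩
  rw [Measure.map_apply hm (.univ_pi hs)]
  have : (fun z : (Fin k → G) × (Fin m → G) => concat (k + m) z.1 z.2) ⁻¹' Set.univ.pi s =
      (Set.univ.pi fun i => s (Fin.castAdd m i)) ×ˢ (Set.univ.pi fun i => s (Fin.natAdd k i)) := by
    ext z
    simp only [Set.mem_preimage, Set.mem_univ_pi, Set.mem_prod, concat_eq_append, Fin.forall_fin_add,
      Fin.append_left, Fin.append_right]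
  rw [this, Measure.prod_prod, Measure.pi_pi, Measure.pi_pi, Fin.prod_univ_add]

end Concat

section Exact

variable {G : Type*} [Group G] [TopologicalSpace G] [IsTopologicalGroup G]
  [LocallyCompactSpace G] [SecondCountableTopology G] [T2Space G]
  [MeasurableSpace G] [BorelSpace G] {μ : Measure G} [μ.IsHaarMeasure]
  {A : Type*} [AddCommGroup A] [TopologicalSpace A] [IsTopologicalAddGroup A] {k m : ℕ}
  {F H : (Fin k → G) × (Fin m → G) → A}

theorem measurable_removeNth {n : ℕ} (i : Fin (n + 1)) :
    Measurable fun x : Fin (n + 1) → G => i.removeNth x :=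
  measurable_pi_lambda _ fun _ => measurable_pi_apply _

theorem stronglyMeasurable_dLeft (hF : StronglyMeasurable F) : StronglyMeasurable (dLeft F) :=
  Finset.stronglyMeasurable_fun_sum Finset.univ fun i _ => (hF.comp_measurable
    (((measurable_removeNth i).comp measurable_fst).prodMk measurable_snd)).const_smul ((-1 : ℤ) ^ (k - (i : ℕ)))

theorem stronglyMeasurable_dRight (hF : StronglyMeasurable F) : StronglyMeasurable (dRight F) :=
  Finset.stronglyMeasurable_fun_sum Finset.univ fun i _ => (hF.comp_measurable
    (measurable_fst.prodMk ((measurable_removeNth i).comp measurable_snd))).const_smul ((-1 : ℤ) ^ (m - (i : ℕ)))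

/-- The measure `μ^k × μ^m`. -/
noncomputable abbrev biMeasure (μ : Measure G) (k m : ℕ) :
    Measure ((Fin k → G) × (Fin m → G)) :=
  (powMeasure μ k).prod (powMeasure μ m)

theorem dLeft_congr (h : F =ᵐ[biMeasure μ k m] H) :
    dLeft F =ᵐ[biMeasure μ (k + 1) m] dLeft H := by
  have : ∀ᵐ z ∂biMeasure μ (k + 1) m, ∀ i : Fin (k + 1),
      F (i.removeNth z.1, z.2) = H (i.removeNth z.1, z.2) :=
    ae_all_iff.2 fun i => (QuasiMeasurePreserving.prodMap
      (quasiMeasurePreserving_removeNth μ i) (.id (powMeasure μ m))).ae h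
  filter_upwards [this] with z hz
  simp only [dLeft, dFun, hz]

theorem ae_eq_zero_of_dRight {F : (Fin k → G) × (Fin 0 → G) → A}
    (h : dRight F =ᵐ[biMeasure μ k 1] 0) : F =ᵐ[biMeasure μ k 0] 0 := by
  have h1 : ∀ᵐ x ∂powMeasure μ k, F (x, default) = 0 := by
    filter_upwards [Measure.ae_ae_of_ae_prod h] with x hx
    obtain ⟨y, hy⟩ := hx.exists
    simpa [dRight, dFun, Subsingleton.elim _ (default : Fin 0 → G)] using hy
  filter_upwards [Measure.quasiMeasurePreserving_fst.ae h1] with z hz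
  rwa [← Prod.mk.eta (p := z), Subsingleton.elim z.2 default]

/-- Exactness of the rows of the double complex of equivariant functions. -/
theorem exists_dRight_eq [DistribMulAction G A]
    {F : (Fin (k + 1) → G) × (Fin (m + 1) → G) → A} (hF : StronglyMeasurable F)
    (hFe : IsEquivariant F) (hd : dRight F =ᵐ[biMeasure μ (k + 1) (m + 2)] 0) :
    ∃ H : (Fin (k + 1) → G) × (Fin m → G) → A, StronglyMeasurable H ∧ IsEquivariant H ∧
      F =ᵐ[biMeasure μ (k + 1) (m + 1)] dRight H := by
  -- Freezing the last variable at `x 0 * t` instead of `t` keeps the slice equivariant. Left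
  -- invariance of `μ` still makes almost every `t` admissible.
  let S : ∀ n, G → (Fin (k + 1) → G) × (Fin n → G) → (Fin (k + 1) → G) × (Fin (n + 1) → G) :=
    fun n t z => (z.1, Fin.insertNth (α := fun _ => G) (Fin.last n) (z.1 0 * t) z.2)
  have hSm : ∀ n, Measurable fun z : G × ((Fin (k + 1) → G) × (Fin n → G)) => S n z.1 z.2 := by
    intro n
    refine (measurable_fst.comp measurable_snd).prodMk ?_
    exact (MeasurableEquiv.piFinSuccAbove (fun _ => G) (Fin.last n)).symm.measurable.comp
      (f := fun z : G × ((Fin (k + 1) → G) × (Fin n → G)) => (z.2.1 0 * z.1, z.2.2))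
      (by fun_prop)
  have hae : ∀ᵐ t ∂μ, ∀ᵐ z ∂biMeasure μ (k + 1) (m + 1), dRight F (S (m + 1) t z) = 0 := by
    have h1 := MeasurePreserving.skew_product (μc := μ.prod (powMeasure μ (m + 1)))
      (μd := powMeasure μ (m + 2)) (.id (powMeasure μ (k + 1)))
      (g := fun x z => Fin.insertNth (α := fun _ => G) (Fin.last (m + 1)) (x 0 * z.1) z.2)
      ((MeasurableEquiv.piFinSuccAbove (fun _ => G) (Fin.last (m + 1))).symm.measurable.comp
        (f := fun z : (Fin (k + 1) → G) × G × (Fin (m + 1) → G) => (z.1 0 * z.2.1, z.2.2))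
        (by fun_prop))
      (Eventually.of_forall fun x => ((measurePreserving_piFinSuccAbove (fun _ => μ)
        (Fin.last (m + 1))).symm.comp ((measurePreserving_mul_left μ (x 0)).prod
          (.id (powMeasure μ (m + 1))))).map_eq)
    have h2 := (measurePreserving_prodAssoc (powMeasure μ (k + 1)) μ (powMeasure μ (m + 1))).comp
      (((Measure.measurePreserving_swap (μ := μ) (ν := powMeasure μ (k + 1))).prod
        (.id (powMeasure μ (m + 1)))).comp
          (measurePreserving_prodAssoc μ (powMeasure μ (k + 1)) (powMeasure μ (m + 1))).symm)
    exact Measure.ae_ae_of_ae_prod (p := fun z => dRight F (S (m + 1) z.1 z.2) = 0)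
      ((h1.comp h2).quasiMeasurePreserving.ae hd)
  obtain ⟨t, ht⟩ := hae.exists
  refine ⟨fun z => F (S m t z), hF.comp_measurable ((hSm m).comp measurable_prodMk_left), ?_, ?_⟩
  · intro g x y
    change F (S m t (fun i => g * x i, fun i => g * y i)) = g • F (S m t (x, y))
    have e : S m t (fun i => g * x i, fun i => g * y i) =
        (fun i => g * (S m t (x, y)).1 i, fun i => g * (S m t (x, y)).2 i) := by
      refine Prod.ext rfl ?_
      funext i
      simp only [S]
      refine Fin.lastCases ?_ (fun j => ?_) i
      · simp [mul_assoc]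
      · simp [Fin.insertNth_last']
    exact (congrArg F e).trans (hFe g _ _)
  · filter_upwards [ht] with z hz
    have := dFun_insertNth_last (fun y => F (z.1, y)) (z.1 0 * t) z.2
    exact sub_eq_zero.1 (this.symm.trans hz)

end Exact
end MooreCohomology

/-! ### Equivariant representatives and the comparison of classes -/

namespace MooreCohomology

open scoped ENNReal

set_option linter.unusedSectionVars false

variable {G : Type*} [Group G] [TopologicalSpace G] [IsTopologicalGroup G]
  [LocallyCompactSpace G] [SecondCountableTopology G] [T2Space G]
  [MeasurableSpace G] [BorelSpace G] {μ : Measure G} [μ.IsHaarMeasure]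
  {A : Type*} [AddCommGroup A] [TopologicalSpace A] [IsTopologicalAddGroup A]

section Representatives

variable {k m : ℕ}

theorem ae_eq_of_forall_ae_eq [PolishSpace A] {F H : (Fin k → G) × (Fin m → G) → A}
    (hF : StronglyMeasurable F) (hH : StronglyMeasurable H)
    (h : ∀ x, ∀ᵐ y ∂powMeasure μ m, F (x, y) = H (x, y)) : F =ᵐ[biMeasure μ k m] H :=
  (Measure.ae_prod_iff_ae_ae (hF.measurableSet_eq_fun hH)).2 (Eventually.of_forall h)

theorem dLeft_eq_of_forall_ae_eq {F : (Fin k → G) × (Fin m → G) → A}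
    {b : (Fin k → G) → Cochain μ A m} (h : ∀ x, ∀ᵐ y ∂powMeasure μ m, F (x, y) = b x y)
    (x : Fin (k + 1) → G) : ∀ᵐ y ∂powMeasure μ m, dLeft F (x, y) = dFun b x y := by
  have h1 : ∀ᵐ y ∂powMeasure μ m, ∀ i : Fin (k + 1), F (i.removeNth x, y) = b (i.removeNth x) y :=
    ae_all_iff.2 fun i => h _
  have h2 : ∀ᵐ y ∂powMeasure μ m, ∀ i : Fin (k + 1),
      ((-1 : ℤ) ^ (k - (i : ℕ)) • b (i.removeNth x)) y =
        (-1 : ℤ) ^ (k - (i : ℕ)) • b (i.removeNth x) y :=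
    ae_all_iff.2 fun i => AEEqFun.coeFn_smul _ _
  filter_upwards [h1, h2, coeFn_sum Finset.univ fun i : Fin (k + 1) =>
    (-1 : ℤ) ^ (k - (i : ℕ)) • b (i.removeNth x)] with y h1 h2 h3
  refine Eq.trans ?_ h3.symm
  simp only [dLeft, dFun, h1, h2]

theorem dRight_eq_of_forall_ae_eq {F : (Fin k → G) × (Fin m → G) → A}
    {b : (Fin k → G) → Cochain μ A m} (h : ∀ x, ∀ᵐ y ∂powMeasure μ m, F (x, y) = b x y)
    (x : Fin k → G) : ∀ᵐ y ∂powMeasure μ (m + 1), dRight F (x, y) = d μ A m (b x) y :=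
  (dFun_congr μ A (h x)).trans (coeFn_d μ A (b x)).symm

variable [DistribMulAction G A] [ContinuousSMul G A]

theorem NiceAt.exists_equivariant_joint [PolishSpace A] {C : CompactExhaustion G} {V : ℕ → Set A}
    (hV : IsNhdsChain V) {u : (Fin k → G) → Cochain μ A m}
    (hu : NiceAt (smallSet μ C V m) (powMeasure μ k) 1 u) :
    ∃ U : (Fin (k + 1) → G) × (Fin m → G) → A, StronglyMeasurable U ∧ IsEquivariant U ∧
      ∀ x, ∀ᵐ y ∂powMeasure μ m, U (x, y) = MooreCohomology.homog u x y := by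
  obtain ⟨U, hU, hUu⟩ := hu.exists_joint hV
  refine ⟨fun z => z.1 0 • U (fun i => (z.1 0)⁻¹ * z.1 i.succ, fun i => (z.1 0)⁻¹ * z.2 i),
    ?_, ?_, fun x => ?_⟩
  · refine StronglyMeasurable.smul (f := fun z : (Fin (k + 1) → G) × (Fin m → G) => z.1 0)
      (Measurable.stronglyMeasurable (by fun_prop)) (hU.comp_measurable (by fun_prop))
  · intro g x y
    simp only [mul_inv_rev, mul_assoc, inv_mul_cancel_left, mul_smul]
  · filter_upwards [coeFn_diagAct μ A (x 0) (u fun i => (x 0)⁻¹ * x i.succ),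
      (measurePreserving_translate μ m (x 0)⁻¹).quasiMeasurePreserving.ae
        (hUu fun i => (x 0)⁻¹ * x i.succ)] with y h1 h2
    rw [h2]
    exact h1.symm

/-- Invariant classes have representatives that are equivariant at every point. -/
theorem exists_equivariant_representative [PolishSpace A] {n : ℕ} (φ : Cochain μ A (n + 1))
    (hφ : φ ∈ invariants μ A (n + 1)) : ∃ σ : (Fin (n + 1) → G) → A, StronglyMeasurable σ ∧
      (∀ (g : G) x, σ (fun i => g * x i) = g • σ x) ∧ φ =ᵐ[powMeasure μ (n + 1)] σ := by
  let sh : G × (Fin n → G) → Fin (n + 1) → G := fun z =>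
    Fin.insertNth (α := fun _ => G) 0 z.1 fun i => z.1 * z.2 i
  have hsh : MeasurePreserving sh (μ.prod (powMeasure μ n)) (powMeasure μ (n + 1)) :=
    (measurePreserving_piFinSuccAbove (fun _ => μ) 0).symm.comp
      ((MeasurePreserving.id μ).skew_product (g := fun t (z : Fin n → G) i => t * z i)
        (by fun_prop) (Eventually.of_forall fun t => (measurePreserving_translate μ n t).map_eq))
  have hsh' : MeasurePreserving
      (fun x : Fin (n + 1) → G => (x 0, fun i : Fin n => (x 0)⁻¹ * x i.succ))
      (powMeasure μ (n + 1)) (μ.prod (powMeasure μ n)) :=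
    ((MeasurePreserving.id μ).skew_product (g := fun t (z : Fin n → G) i => t⁻¹ * z i)
        (by fun_prop) (Eventually.of_forall fun t =>
          (measurePreserving_translate μ n t⁻¹).map_eq)).comp
      (measurePreserving_piFinSuccAbove (fun _ => μ) 0)
  -- In the coordinates `(t, z) ↦ (t, t z)`, invariance of `φ` says that `Φ` does not depend on `t`.
  -- Freezing `t = h` yields the representative.
  let Φ : G × (Fin n → G) → A := fun w => w.1⁻¹ • φ (sh w)
  have hΦ : StronglyMeasurable Φ :=
    StronglyMeasurable.smul (f := fun w : G × (Fin n → G) => w.1⁻¹)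
      (Measurable.stronglyMeasurable (by fun_prop)) (φ.stronglyMeasurable.comp_measurable
        hsh.measurable)
  have h1 : ∀ g : G, ∀ᵐ w ∂μ.prod (powMeasure μ n), Φ w = Φ (g⁻¹ * w.1, w.2) := by
    intro g
    have h := coeFn_diagAct μ A g φ
    rw [show diagAct μ g φ = φ from AddSubgroup.mem_iInf.1 hφ g] at h
    filter_upwards [hsh.quasiMeasurePreserving.ae h] with w hw
    have e : (fun i => g⁻¹ * sh w i) = sh (g⁻¹ * w.1, w.2) := by
      ext i
      refine Fin.cases ?_ (fun j => ?_) i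
      · simp [sh]
      · simp [sh, mul_assoc]
    simp only [Φ]
    rw [hw, e, mul_inv_rev, inv_inv, mul_smul]
  have hmeas : MeasurableSet {z : G × (G × (Fin n → G)) | Φ z.2 = Φ (z.1⁻¹ * z.2.1, z.2.2)} :=
    (hΦ.comp_measurable measurable_snd).measurableSet_eq_fun (hΦ.comp_measurable (by fun_prop))
  -- The null set in `h1` depends on `g`; Fubini exchanges the quantifiers, and then `h = g⁻¹ * w.1`
  -- replaces `g`.
  have h2 : ∀ᵐ w ∂μ.prod (powMeasure μ n), ∀ᵐ h ∂μ, Φ w = Φ (h, w.2) := by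
    filter_upwards [(Measure.ae_ae_comm (μ := μ) (ν := μ.prod (powMeasure μ n))
      (p := fun g w => Φ w = Φ (g⁻¹ * w.1, w.2)) hmeas).1 (Eventually.of_forall h1)] with w hw
    have hq : Measure.QuasiMeasurePreserving (fun h => w.1 * h⁻¹) μ μ :=
      (measurePreserving_mul_left μ w.1).quasiMeasurePreserving.comp
        (quasiMeasurePreserving_inv μ)
    filter_upwards [hq.ae hw] with h hh
    simpa using hh
  have hmeas' : MeasurableSet {z : (G × (Fin n → G)) × G | Φ z.1 = Φ (z.2, z.1.2)} :=
    (hΦ.comp_measurable measurable_fst).measurableSet_eq_fun (hΦ.comp_measurable (by fun_prop))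
  obtain ⟨h, hh⟩ := ((Measure.ae_ae_comm (p := fun w h => Φ w = Φ (h, w.2)) hmeas').1 h2).exists
  refine ⟨fun x => x 0 • Φ (h, fun i => (x 0)⁻¹ * x i.succ), ?_, fun g x => ?_, ?_⟩
  · exact StronglyMeasurable.smul (f := fun x : Fin (n + 1) → G => x 0)
      (Measurable.stronglyMeasurable (by fun_prop)) (hΦ.comp_measurable (by fun_prop))
  · simp only [mul_inv_rev, mul_assoc, inv_mul_cancel_left, mul_smul]
  · filter_upwards [hsh'.quasiMeasurePreserving.ae hh] with x hx
    rw [← hx]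
    simp only [Φ]
    rw [smul_inv_smul]
    congr 1
    ext i
    refine Fin.cases ?_ (fun j => ?_) i
    · simp [sh]
    · simp [sh]

end Representatives

section Chase

variable [DistribMulAction G A] [ContinuousSMul G A]

/-- The restrictions of `σ` to different block shapes form a zigzag with the same sign `(-1)^m` as
the dimension shift, so differences propagate from stage to stage. -/
theorem ae_dRight_concat {n : ℕ} {σ : (Fin n → G) → A} (hσ : dFun σ =ᵐ[powMeasure μ (n + 1)] 0)
    {k m : ℕ} (h : n = k + 1 + m) :
    dRight (fun z : (Fin (k + 1) → G) × (Fin m → G) => σ (concat n z.1 z.2))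
      =ᵐ[biMeasure μ (k + 1) (m + 1)] (-1 : ℤ) ^ m •
        dLeft (fun z : (Fin k → G) × (Fin (m + 1) → G) => σ (concat n z.1 z.2)) := by
  filter_upwards [(measurePreserving_concat μ (k := k + 1) (m := m + 1)
    (show n + 1 = k + 1 + (m + 1) by omega)).quasiMeasurePreserving.ae hσ] with z hz
  rw [dFun_concat h σ z.1 z.2, pow_succ, mul_neg_one, neg_smul] at hz
  exact (neg_add_eq_zero.1 hz).symm

variable [PolishSpace A] {C : CompactExhaustion G} {V : ℕ → Set A}

/-- The chain of almost type-I cochains obtained by dimension shifting from a cocycle `σ`. Their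
jointly measurable representatives differ from `σ` by coboundaries in the double complex. -/
theorem exists_shifted_cochain (hV : IsNhdsChain V) {p : ℕ} {σ : (Fin (p + 1) → G) → A}
    (hσ : StronglyMeasurable σ) (hσe : ∀ (g : G) x, σ (fun i => g * x i) = g • σ x)
    (hσd : dFun σ =ᵐ[powMeasure μ (p + 2)] 0) (k m : ℕ) (hkm : k + m = p) :
    ∃ u : (Fin k → G) → Cochain μ A m, NiceAt (smallSet μ C V m) (powMeasure μ k) 1 u ∧
      (∀ x, d μ A m (dFun (homog u) x) = 0) ∧
      ∃ U : (Fin (k + 1) → G) × (Fin m → G) → A, StronglyMeasurable U ∧ IsEquivariant U ∧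
        (∀ x, ∀ᵐ y ∂powMeasure μ m, U (x, y) = homog u x y) ∧
        ∃ w : (Fin k → G) × (Fin m → G) → A, StronglyMeasurable w ∧ IsEquivariant w ∧
          (k = 0 → w = 0) ∧ dRight (U - (fun z => σ (concat (p + 1) z.1 z.2)) - dLeft w)
            =ᵐ[biMeasure μ (k + 1) (m + 1)] 0 := by
  induction k generalizing m with
  | zero =>
    obtain rfl : m = p := by omega
    let φ : Cochain μ A (m + 1) := AEEqFun.mk σ hσ.aestronglyMeasurable
    have hφσ : φ =ᵐ[powMeasure μ (m + 1)] σ := AEEqFun.coeFn_mk _ _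
    have hφd : d μ A (m + 1) φ = 0 := AEEqFun.ext ((coeFn_d μ A φ).trans
      (((dFun_congr μ A hφσ).trans hσd).trans AEEqFun.coeFn_zero.symm))
    have hφe : ∀ g : G, diagAct μ g φ = φ := fun g => by
      refine AEEqFun.ext ((coeFn_diagAct μ A g φ).trans ?_)
      filter_upwards [hφσ, (measurePreserving_translate μ (m + 1) g⁻¹).quasiMeasurePreserving.ae
        hφσ] with x h1 h2
      rw [h1, h2, hσe, smul_inv_smul]
    obtain ⟨j, hj⟩ := exists_d_eq (μ := μ) (C := C) (m := m) hV 0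
    -- The sign matches `ae_dRight_concat` at `k = 0`, so that `w = 0` works at the first stage.
    obtain ⟨ψ, hψ, -⟩ := hj ((-1 : ℤ) ^ m • φ) (by rw [map_zsmul, hφd, smul_zero])
    have hu := NiceAt.const (isAddChain_smallSet (μ := μ) (C := C) (m := m) hV.toIsAddChain)
      (powMeasure μ 0) 1 ψ
    have hdu : ∀ x : Fin 1 → G, d μ A m (homog (fun _ : Fin 0 → G => ψ) x) = (-1 : ℤ) ^ m • φ := fun x => by
      rw [d_homog, homog, hψ, map_zsmul, hφe]
    obtain ⟨U, hU, hUe, hUu⟩ := hu.exists_equivariant_joint hV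
    refine ⟨fun _ => ψ, hu, fun x => ?_, U, hU, hUe, hUu, 0, stronglyMeasurable_const,
      fun g x y => (smul_zero g).symm, fun _ => rfl, ?_⟩
    · rw [d_dFun_comm]
      unfold dFun
      rw [Fin.sum_univ_two]
      beta_reduce
      rw [hdu, hdu]
      simp
    · have h0 : dLeft (0 : (Fin 0 → G) × (Fin m → G) → A) = 0 := by
        funext z
        simp [dLeft, dFun]
      rw [h0, sub_zero, dRight_sub]
      have e1 : dRight U =ᵐ[biMeasure μ 1 (m + 1)] (-1 : ℤ) ^ m • (σ ∘ Prod.snd) :=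
        ae_eq_of_forall_ae_eq (stronglyMeasurable_dRight hU)
          ((hσ.comp_measurable measurable_snd).const_smul ((-1 : ℤ) ^ m)) fun x => by
            filter_upwards [dRight_eq_of_forall_ae_eq hUu x,
              AEEqFun.coeFn_smul ((-1 : ℤ) ^ m) φ, hφσ] with y h1 h2 h3
            rw [h1, hdu, h2, Pi.smul_apply, Pi.smul_apply, h3, Function.comp_apply]
      have e2 := ae_dRight_concat (μ := μ) hσd (k := 0) (m := m) (by omega)
      filter_upwards [e1, e2] with z h1 h2
      rw [Pi.sub_apply, h1, h2, Pi.smul_apply]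
      simp [dLeft, dFun, zero_concat]
  | succ k ih =>
    obtain ⟨u, hu, hud, U, hU, hUe, hUu, w, hw, hwe, -, hUw⟩ := ih (m + 1) (by omega)
    obtain ⟨v, hv, hvu, hvd⟩ := hu.exists_shift hV hud m
    obtain ⟨U', hU', hUe', hUu'⟩ := hv.exists_equivariant_joint hV
    let s : (Fin (k + 1) → G) × (Fin (m + 1) → G) → A := fun z => σ (concat (p + 1) z.1 z.2)
    have hs : StronglyMeasurable s :=
      hσ.comp_measurable (measurePreserving_concat μ (by omega)).measurable
    have hse : IsEquivariant s := fun g x y => by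
      simp only [s]
      rw [← hσe, concat_translate (by omega)]
    -- The discrepancy of the previous stage is `dRight H`. Applying `dLeft` kills its `dLeft w`
    -- term and commutes with `dRight`, so `(-1)^m • H` is the correction at the next stage.
    obtain ⟨H, hH, hHe, hFH⟩ := exists_dRight_eq (μ := μ)
      ((hU.sub hs).sub (stronglyMeasurable_dLeft hw)) ((hUe.sub hse).sub hwe.dLeft) hUw
    refine ⟨v, hv, hvd, U', hU', hUe', hUu', (-1 : ℤ) ^ m • H, hH.const_smul _, hHe.zsmul _,
      fun h => absurd h (Nat.succ_ne_zero k), ?_⟩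
    have e1 : dRight U' =ᵐ[biMeasure μ (k + 2) (m + 1)] (-1 : ℤ) ^ m • dLeft U :=
      ae_eq_of_forall_ae_eq (stronglyMeasurable_dRight hU')
        ((stronglyMeasurable_dLeft hU).const_smul _) fun x => by
          filter_upwards [dRight_eq_of_forall_ae_eq hUu' x, dLeft_eq_of_forall_ae_eq hUu x,
            AEEqFun.coeFn_smul ((-1 : ℤ) ^ m) (dFun (homog u) x)] with y h1 h2 h3
          rw [h1, hvu, h3, Pi.smul_apply, Pi.smul_apply, h2]
    have e2 := ae_dRight_concat (μ := μ) hσd (k := k + 1) (m := m) (by omega)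
    filter_upwards [e1, e2, dLeft_congr hFH] with z h1 h2 h3
    rw [dLeft_sub, dLeft_sub, dLeft_dLeft, sub_zero] at h3
    rw [dRight_sub, dRight_sub, Pi.sub_apply, Pi.sub_apply, h1, h2, dLeft_zsmul, dRight_zsmul,
      dRight_dLeft, Pi.smul_apply, Pi.smul_apply, Pi.smul_apply, ← h3, ← smul_sub, ← smul_sub]
    simp [s]

end Chase

end MooreCohomology

/-! ### Continuity, evaluation on `G^0`, and the theorem -/

namespace MooreCohomology

open scoped ENNReal

set_option linter.unusedSectionVars false

section Continuity

variable {X : Type*} [TopologicalSpace X] [WeaklyLocallyCompactSpace X]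
  {A : Type*} [AddCommGroup A] [TopologicalSpace A] [IsTopologicalAddGroup A]

theorem TendstoCompactly.continuousAt {V : ℕ → Set A} (hV : IsNhdsChain V) {γ : ℕ → X → A}
    {f : X → A} (h : TendstoCompactly γ f) {x : X} (hx : ∀ n, LocallyConstantAround (γ n) x) :
    ContinuousAt f x := by
  obtain ⟨K, hK, hxK⟩ := exists_compact_mem_nhds x
  refine hV.tendsto_iff.2 fun j => ?_
  obtain ⟨n, hn⟩ := (h K hK (V (j + 1)) (hV.mem_nhds _)).exists
  filter_upwards [hxK, hx n] with y hyK hy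
  have := hV.sub_mem (hn x (mem_of_mem_nhds hxK)) (hn y hyK)
  rwa [hy, sub_sub_sub_cancel_left] at this

theorem TendstoCompactly.tendsto {γ : ℕ → X → A} {f : X → A} (h : TendstoCompactly γ f) (x : X) :
    Tendsto (fun n => γ n x) atTop (𝓝 (f x)) :=
  tendsto_sub_nhds_zero_iff.1 fun W hW =>
    (h {x} isCompact_singleton W hW).mono fun _ hn => hn x rfl

end Continuity

variable {G : Type*} [Group G] [TopologicalSpace G] [IsTopologicalGroup G]
  [LocallyCompactSpace G] [SecondCountableTopology G] [T2Space G]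
  [MeasurableSpace G] [BorelSpace G] {μ : Measure G} [μ.IsHaarMeasure]
  {A : Type*} [AddCommGroup A] [TopologicalSpace A] [IsTopologicalAddGroup A]

section Evaluation

theorem NiceAt.exists_typeIAt_tendstoCompactly {X : Type*} [TopologicalSpace X]
    [MeasurableSpace X] {ν : Measure X} {x₀ : X} {C : CompactExhaustion G} {V : ℕ → Set A}
    (hV : IsNhdsChain V) {u : X → Cochain μ A 0} (hu : NiceAt (smallSet μ C V 0) ν x₀ u)
    (y : Fin 0 → G) : ∃ γ : ℕ → X → A, (∀ n, TypeIAt ν x₀ (γ n)) ∧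
      TendstoCompactly γ fun x => u x y := by
  obtain ⟨γ, h1, h2⟩ := hu
  refine ⟨fun n x => γ n x y, fun n => (h1 n).map fun φ => φ y, fun K hK W hW => ?_⟩
  obtain ⟨j, hj⟩ := hV.exists_subset W hW
  filter_upwards [h2 K hK (j + 1)] with n hn x hx
  have h3 := ae_powMeasure_zero (AEEqFun.coeFn_sub (γ n x) (u x)) y
  rw [Pi.sub_apply] at h3
  rw [← h3]
  exact hj (hV.antitone j.le_succ (apply_mem_of_mem_smallSet (hn x hx) y))

/-- The inner `d` is injective on `C(G^0, A)`, and an almost sure identity on the single point of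
`G^0` is an identity. -/
theorem dFun_apply_eq_zero {n : ℕ} {b : (Fin n → G) → Cochain μ A 0}
    (hb : ∀ x, d μ A 0 (dFun b x) = 0) (y : Fin 0 → G) (x : Fin (n + 1) → G) :
    dFun (fun x => b x y) x = 0 := by
  have h := ae_powMeasure_zero (dLeft_eq_of_forall_ae_eq (μ := μ) (b := b)
    (F := fun z => b z.1 z.2) (fun x => Eventually.of_forall fun _ => rfl) x) y
  rw [eq_zero_of_d_eq_zero (hb x)] at h
  exact h.trans (ae_powMeasure_zero AEEqFun.coeFn_zero y)

end Evaluation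

section Classes

variable [DistribMulAction G A] [ContinuousSMul G A]

theorem mk_mem_invariants {n : ℕ} {f : (Fin n → G) → A} (hf : StronglyMeasurable f)
    (hfe : ∀ (g : G) x, f (fun i => g * x i) = g • f x) :
    AEEqFun.mk f hf.aestronglyMeasurable ∈ invariants μ A n := by
  have h := AEEqFun.coeFn_mk (μ := powMeasure μ n) f hf.aestronglyMeasurable
  refine AddSubgroup.mem_iInf.2 fun g => AEEqFun.ext ((coeFn_diagAct μ A g _).trans ?_)
  filter_upwards [h, (measurePreserving_translate μ n g⁻¹).quasiMeasurePreserving.ae h] with x h1 h2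
  rw [h2, hfe, smul_inv_smul]
  exact h1.symm

theorem mk_mem_cocycles {p : ℕ} {f : (Fin (p + 1) → G) → A} (hf : StronglyMeasurable f)
    (hfe : ∀ (g : G) x, f (fun i => g * x i) = g • f x) (hd : ∀ x, dFun f x = 0) :
    AEEqFun.mk f hf.aestronglyMeasurable ∈ cocycles μ A p := by
  refine ⟨mk_mem_invariants hf hfe, AEEqFun.ext ((coeFn_d μ A _).trans
    ((dFun_congr μ A (AEEqFun.coeFn_mk _ _)).trans ?_))⟩
  filter_upwards [AEEqFun.coeFn_zero (μ := powMeasure μ (p + 2)) (α := Fin (p + 2) → G) (β := A)]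
    with x hx
  rw [hd, hx]
  rfl

/-- The complex starts at `C(G, A)^G`, so in degree `0` only zero is a coboundary; hence the
condition on `w` there. -/
theorem sub_mem_coboundaries {p : ℕ} {φ ψ : Cochain μ A (p + 1)} {w : (Fin p → G) → A}
    (hw : StronglyMeasurable w) (hwe : ∀ (g : G) x, w (fun i => g * x i) = g • w x)
    (hw0 : p = 0 → w = 0) (h : ↑(φ - ψ) =ᵐ[powMeasure μ (p + 1)] dFun w) :
    φ - ψ ∈ coboundaries μ A p := by
  have hsub : d μ A p (AEEqFun.mk w hw.aestronglyMeasurable) = φ - ψ :=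
    AEEqFun.ext ((coeFn_d μ A _).trans ((dFun_congr μ A (AEEqFun.coeFn_mk _ _)).trans
      h.symm))
  cases p with
  | zero =>
    obtain rfl := hw0 rfl
    rw [← hsub]
    exact (map_zero (d μ A 0) : d μ A 0 0 = 0)
  | succ p => exact ⟨_, mk_mem_invariants hw hwe, hsub⟩

end Classes

end MooreCohomology

open MooreCohomology in
theorem theoremB {G : Type*} [Group G] [TopologicalSpace G] [IsTopologicalGroup G]
    [LocallyCompactSpace G] [SecondCountableTopology G] [T2Space G]
    [MeasurableSpace G] [BorelSpace G] (μ : MeasureTheory.Measure G) [μ.IsHaarMeasure]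
    {A : Type*} [AddCommGroup A] [TopologicalSpace A] [IsTopologicalAddGroup A] [PolishSpace A]
    [DistribMulAction G A] [ContinuousSMul G A]
    (p : ℕ) (c : MooreCohomology.Hm μ A p) :
    ∃ (f : (Fin (p + 1) → G) → A) (hf : StronglyMeasurable f)
      (z : MooreCohomology.cocycles μ A p),
      -- `f` represents the class `c`
      (z : MooreCohomology.Cochain μ A (p + 1)) = AEEqFun.mk f hf.aestronglyMeasurable ∧
      QuotientAddGroup.mk z = c ∧
      -- `f` is equivariant and satisfies the cocycle identity at every point
      (∀ (g : G) (x : Fin (p + 1) → G), f (fun i => g * x i) = g • f x) ∧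
      (∀ x : Fin (p + 2) → G, MooreCohomology.dFun f x = 0) ∧
      -- `f` is almost type-I and regular at the identity
      MooreCohomology.IsAlmostTypeI (MooreCohomology.powMeasure μ (p + 1)) f ∧
      MooreCohomology.IsRegularAt (MooreCohomology.powMeasure μ (p + 1)) f 1 ∧
      -- `f` is continuous at every point of a dense `G_δ` set of full measure containing `1`
      ∃ S : Set (Fin (p + 1) → G), IsGδ S ∧ Dense S ∧
        MooreCohomology.powMeasure μ (p + 1) Sᶜ = 0 ∧ 1 ∈ S ∧ ∀ x ∈ S, ContinuousAt f x := by

  obtain ⟨z₀, rfl⟩ := QuotientAddGroup.mk_surjective c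
  obtain ⟨V, hV⟩ := exists_isNhdsChain (A := A)
  let C : CompactExhaustion G := default
  obtain ⟨σ, hσ, hσe, hφσ⟩ := exists_equivariant_representative (μ := μ) z₀.1 z₀.2.1
  have hσd : dFun σ =ᵐ[powMeasure μ (p + 2)] 0 := by
    refine (dFun_congr μ A hφσ).symm.trans ((coeFn_d μ A _).symm.trans ?_)
    rw [show d μ A (p + 1) z₀.1 = 0 from z₀.2.2]
    exact AEEqFun.coeFn_zero
  -- The last stage of the shift, `m = 0`: the values are classes on a point, and evaluating them
  -- gives `f`.
  obtain ⟨u, hu, hud, U, hU, hUe, hUu, w, hw, hwe, hw0, hUw⟩ :=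
    exists_shifted_cochain (C := C) hV hσ hσe hσd p 0 rfl
  let y₀ : Fin 0 → G := default
  let f : (Fin (p + 1) → G) → A := fun x => homog u x y₀
  have hfe : ∀ (g : G) x, f (fun i => g * x i) = g • f x := fun g x => by
    simp only [f]
    rw [homog_translate, ae_powMeasure_zero (coeFn_diagAct μ A g _) y₀]
    exact congrArg (fun y => g • homog u x y) (Subsingleton.elim _ y₀)
  have hfd : ∀ x, dFun f x = 0 := dFun_apply_eq_zero hud y₀
  obtain ⟨γ, hγ, hγf⟩ := (hu.homog hV).exists_typeIAt_tendstoCompactly hV y₀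
  have hf : StronglyMeasurable f := by
    borelize A
    exact stronglyMeasurable_of_tendsto atTop
      (fun n => Measurable.stronglyMeasurable fun s _ => (hγ n).measurableSet_preimage s)
      (tendsto_pi_nhds.2 hγf.tendsto)
  refine ⟨f, hf, ⟨_, mk_mem_cocycles hf hfe hfd⟩, rfl, ?_, hfe, hfd,
    ⟨γ, fun n => (hγ n).isTypeI, hγf⟩,
    ⟨γ, fun n => ⟨(hγ n).isTypeI, (hγ n).locallyConstantAround⟩, hγf⟩, ?_⟩
  · rw [eq_comm, QuotientAddGroup.eq, neg_add_eq_sub]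
    refine sub_mem_coboundaries (w := fun x => w (x, y₀))
      (hw.comp_measurable measurable_prodMk_right) (fun g x => ?_) (fun hp => ?_) ?_
    · rw [← hwe, Subsingleton.elim (fun i => g * y₀ i) y₀]
    · rw [hw0 hp]
      rfl
    · filter_upwards [hφσ, AEEqFun.coeFn_mk (μ := powMeasure μ (p + 1)) f hf.aestronglyMeasurable,
        Measure.ae_ae_of_ae_prod (ae_eq_zero_of_dRight hUw),
        AEEqFun.coeFn_sub (AEEqFun.mk f hf.aestronglyMeasurable) z₀.1] with x h1 h2 h3 h5
      have h4 := ae_powMeasure_zero h3 y₀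
      simp only [Pi.sub_apply, concat_zero, Pi.zero_apply] at h4
      rw [ae_powMeasure_zero (hUu x) y₀, sub_eq_zero] at h4
      rw [h5, Pi.sub_apply, h1, h2]
      exact h4
  -- The set `S` is the intersection of the open sets on which the approximants are locally
  -- constant; it is dense because Haar measure charges every nonempty open set.
  · choose O hO hO1 hOnull hOc using fun n => (hγ n).exists_isOpen
    have hnull : powMeasure μ (p + 1) (⋂ n, O n)ᶜ = 0 := by
      rw [Set.compl_iInter]
      exact measure_iUnion_null hOnull
    exact ⟨⋂ n, O n, .iInter_of_isOpen hO, Measure.dense_of_ae (mem_ae_iff.2 hnull), hnull,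
      Set.mem_iInter.2 hO1, fun x hx =>
        hγf.continuousAt hV fun n => hOc n x (Set.mem_iInter.1 hx n)⟩
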